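/- A *dimer* is a finite bipartite graph (multiple edges allowed), with nodes coloured white and black, embedded in the oriented torus $T^2=\mathbb R^2/\mathbb Z^2$ such that every face is an open disc. Put $(a,b)\wedge(c,d)=ad-bc$. A *zigzag path* is a closed path of edges that turns alternately to the counterclockwise next edge around white nodes and to the clockwise next edge around black nodes. It is oriented this way, so each edge belongs to two zigzag paths (possibly equal); its *winding* is its class in $H_1(T^2)=\mathbb Z^2$. The dimer is *properly ordered* if no zigzag path has winding zero, no zigzag path intersects itself, no two zigzag paths with the same winding intersect, and around every node the zigzag paths passing through it occur in the circular order of the directions of their windings, these directions being distinct. Let $\gamma_w,\gamma_z$ be closed curves whose windings $g_w,g_z$ form a basis of $\mathbb Z^2$. Give the edge $e$ the weight $c_e\,w^{a(e)}z^{b(e)}$, where $c_e\in\mathbb C^\times$ is arbitrary, $a(e)$ is the number of crossings of $\gamma_w$ with $e$ having the white endpoint on the left of $\gamma_w$ minus the number of those having it on the right, and $b(e)$ is defined likewise by $\gamma_z$. The *Kasteleyn matrix* has rows indexed by the white nodes and columns indexed by the black nodes, and its entries are the sums of the weights of the edges joining the two nodes. The *toric diagram* $\Delta$ is the Newton polygon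 of its determinant. A *$(p,q)$-leg* of $\Delta$ is the outward normal vector $(p,q)$ obtained by a clockwise rotation by $90^\circ$ of a segment joining consecutive lattice points on the boundary of $\Delta$, the boundary being traversed counterclockwise; legs of different segments are counted separately. The *point* of a perfect matching $M$ is $\sum_{e\in M}(a(e),b(e))$. **Theorem.** Let a properly ordered dimer be given. Then there are as many white as black nodes, and for every choice of the basis, the curves and the coefficients $c_e$ the following hold. 1. There is a bijection between the zigzag paths and the $(p,q)$-legs of $\Delta$ such that a zigzag path corresponding to the leg $(p,q)$ has winding $p\,g_w+q\,g_z$. 2. For a ray $\mathcal R$ from the origin that does not have the direction of the winding of any zigzag path, let $M(\mathcal R)$ consist of the edges chosen by the nodes, where a node $v$ chooses its edge between the two zigzag paths through $v$ whose windings make the smallest clockwise and the smallest counterclockwise angle with $\mathcal R$ (the former path just before, the latter just after the edge, counterclockwise around $v$). Then $M(\mathcal R)$ is a perfect matching, and the corners of $\Delta$ are exactly the points of the matchings $M(\mathcal R)$. 3. Let $\mathcal R_1,\mathcal R_2$ be two such rays, and let $\mathbf w$ be the winding of a zigzag path, such that the windings of zigzag paths whose directions lie between $\mathcal R_1$ and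 $\mathcal R_2$, counterclockwise from $\mathcal R_1$, are precisely those equal to $\mathbf w$. Then the points of $M(\mathcal R_1)$ and $M(\mathcal R_2)$ are distinct consecutive corners of $\Delta$, and the second minus the first is $n\,(\mathbf w\wedge g_w,\ \mathbf w\wedge g_z)$, where $n$ is the number of zigzag paths of winding $\mathbf w$. For $g_w=(1,0)$, $g_z=(0,1)$ this is $n$ times $\mathbf w$ rotated by $90^\circ$ counterclockwise. -/

import Mathlib

noncomputable section

/-! ### Plane vectors -/

/-- The wedge product `(a,b) ∧ (c,d) = a d - b c`. -/
def wedge {R : Type*} [CommRing R] (u v : R × R) : R := u.1 * v.2 - u.2 * v.1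

/-- A lattice vector, seen in the real plane. -/
def toReal (u : ℤ × ℤ) : ℝ × ℝ := ((u.1 : ℝ), (u.2 : ℝ))

/-- Two nonzero vectors point in the same direction. -/
def SameDir {R : Type*} [CommRing R] [LinearOrder R] (u v : R × R) : Prop :=
  wedge u v = 0 ∧ 0 < u.1 * v.1 + u.2 * v.2

/-- The directions of `u`, `v`, `w` are pairwise distinct and are met in this cyclic order when one
turns counterclockwise. The three counterclockwise turns `u → v → w → u` then add up to one
revolution, and this happens exactly when at least two of them are positive and less than a half
turn, i.e. have a positive wedge product. -/
def Ccw {R : Type*} [CommRing R] [LinearOrder R] (u v w : R × R) : Prop :=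
  (0 < wedge u v ∧ 0 < wedge v w) ∨ (0 < wedge v w ∧ 0 < wedge w u) ∨
    (0 < wedge w u ∧ 0 < wedge u v)

/-! ### Dimers on the torus -/

/-- The permutation that follows the boundary of a face, keeping the face on the left: walk along
`e` from white to black, return along the edge that is clockwise next to `e` at the black node, and
continue with the edge that is clockwise next to that one at the white node. -/
def facePerm {E : Type*} (rotW rotB : Equiv.Perm E) : Equiv.Perm E := rotW⁻¹ * rotB⁻¹

/-- The closed oriented surface that is glued from the faces of the rotation system is mapped with
degree one to `ℝ² / ℤ²` when the edge `e`, oriented from white to black, is given the displacement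
`disp e`. Each face boundary lifts to a closed polygon in the plane; `x e` is the corner at which the
lifted boundary of the face on the left of `e` starts to follow `e`. The last equation says that the
signed areas of all the lifted face polygons (by the shoelace formula, doubled) add up to the
area of the torus. -/
def IsToral {E : Type*} [Fintype E] (rotW rotB : Equiv.Perm E) (disp : E → ℤ × ℤ) : Prop :=
  ∃ x : E → ℤ × ℤ,
    (∀ e, x (facePerm rotW rotB e) = x e + disp e - disp (rotB⁻¹ e)) ∧
    ∑ e, (wedge (x e) (x e + disp e) +
      wedge (x e + disp e) (x (facePerm rotW rotB e))) = 2

/-- A dimer with set of edges `E`: a finite bipartite graph, multiple edges allowed, embedded in the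
oriented torus `ℝ² / ℤ²` in such a way that all faces are open discs. The embedding is given, up to
isotopy, by the cyclic order of the edges around the nodes and the displacements of the edges. -/
structure Dimer (E : Type*) [Fintype E] where
  /-- the counterclockwise next edge around the white endpoint -/
  rotW : Equiv.Perm E
  /-- the counterclockwise next edge around the black endpoint -/
  rotB : Equiv.Perm E
  /-- the graph is connected -/
  connected : MulAction.IsPretransitive (Subgroup.closure {rotW, rotB}) E
  /-- the surface has Euler characteristic zero -/
  euler : Nat.card (Quotient (Equiv.Perm.SameCycle.setoid rotW)) +
      Nat.card (Quotient (Equiv.Perm.SameCycle.setoid rotB)) +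
      Nat.card (Quotient (Equiv.Perm.SameCycle.setoid (facePerm rotW rotB))) = Fintype.card E
  /-- the displacement of an edge from its white to its black endpoint in the universal cover `ℝ²`,
  once for each node a lift has been fixed as the origin of its `ℤ²`-orbit -/
  disp : E → ℤ × ℤ
  /-- the displacements identify the surface with `ℝ² / ℤ²`, preserving orientations -/
  toral : IsToral rotW rotB disp

namespace Dimer

variable {E : Type*} [Fintype E] (D : Dimer E)

/-- The white nodes: the orbits of the rotation of edges around white endpoints. -/
def White : Type _ := Quotient (Equiv.Perm.SameCycle.setoid D.rotW)

/-- The black nodes. -/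
def Black : Type _ := Quotient (Equiv.Perm.SameCycle.setoid D.rotB)

/-- The white endpoint of an edge. -/
def white (e : E) : D.White := Quotient.mk (Equiv.Perm.SameCycle.setoid D.rotW) e

/-- The black endpoint of an edge. -/
def black (e : E) : D.Black := Quotient.mk (Equiv.Perm.SameCycle.setoid D.rotB) e

instance : Finite D.White := inferInstanceAs (Finite (Quotient _))

instance : Finite D.Black := inferInstanceAs (Finite (Quotient _))

instance : Fintype D.White := Fintype.ofFinite _

instance : Fintype D.Black := Fintype.ofFinite _

instance : DecidableEq D.White := Classical.decEq _

instance : DecidableEq D.Black := Classical.decEq _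

/-! ### Zigzag paths -/

/-- Two steps along a zigzag path: from `e` to the counterclockwise next edge around the white node,
and then to the clockwise next edge around the black node. -/
def zigzagPerm : Equiv.Perm E := D.rotB⁻¹ * D.rotW

/-- Zigzag paths, oriented counterclockwise around white and clockwise around black nodes. The path
through `e`, `rotW e`, `rotB⁻¹ (rotW e)`, … is the cycle of `zigzagPerm` that contains `e`. -/
def ZigzagPath : Type _ := Quotient (Equiv.Perm.SameCycle.setoid D.zigzagPerm)

/-- The zigzag path that turns counterclockwise from `e` to `rotW e` at the white endpoint of `e`.
It runs along `e` from black to white. -/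
def zigOut (e : E) : D.ZigzagPath := Quotient.mk (Equiv.Perm.SameCycle.setoid D.zigzagPerm) e

/-- The other zigzag path through `e`: it turns from `rotW⁻¹ e` to `e` at the white endpoint and then
from `e` to `rotB⁻¹ e` at the black endpoint. It runs along `e` from white to black. -/
def zigIn (e : E) : D.ZigzagPath := D.zigOut (D.rotW⁻¹ e)

instance : Finite D.ZigzagPath := inferInstanceAs (Finite (Quotient _))

instance : DecidableEq D.ZigzagPath := Classical.decEq _

/-- The winding of a zigzag path: its total displacement in the universal cover. -/
def winding (Z : D.ZigzagPath) : ℤ × ℤ :=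
  ∑ e with D.zigOut e = Z, (D.disp (D.rotW e) - D.disp e)

/-- Around the node whose edges, counterclockwise, are `e`, `ρ e`, `ρ (ρ e)`, …, the corresponding
zigzag paths `P e`, `P (ρ e)`, … are in the circular order of the directions of their windings, and
these directions are distinct. The minimal period is the valence of the node. -/
def OrderedAround (ρ : Equiv.Perm E) (P : E → D.ZigzagPath) (e : E) : Prop :=
  (∀ i j : ℕ, i < j → j < Function.minimalPeriod ρ e →
    ¬ SameDir (D.winding (P ((ρ ^ i) e))) (D.winding (P ((ρ ^ j) e)))) ∧
  (∀ i j k : ℕ, i < j → j < k → k < Function.minimalPeriod ρ e →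
    Ccw (D.winding (P ((ρ ^ i) e))) (D.winding (P ((ρ ^ j) e))) (D.winding (P ((ρ ^ k) e))))

/-- Properly ordered dimers: no zigzag path has winding zero, no two zigzag paths with the same
winding intersect (in particular none intersects itself), and around each node the order of the
zigzag paths is the circular order of the directions of their windings. At a white node, `zigOut e`
occupies the corner between `e` and `rotW e`; at a black node, `zigIn e` occupies the corner between
`rotB⁻¹ e` and `e`. -/
structure ProperlyOrdered : Prop where
  winding_ne_zero : ∀ Z : D.ZigzagPath, D.winding Z ≠ 0
  winding_ne : ∀ e, D.winding (D.zigIn e) ≠ D.winding (D.zigOut e)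
  white_ordered : ∀ e, D.OrderedAround D.rotW D.zigOut e
  black_ordered : ∀ e, D.OrderedAround D.rotB D.zigIn e

/-! ### The Kasteleyn matrix -/

/-- The exponent `(a, b)` of the weight of an edge, for curves `γ_w`, `γ_z` with windings `gw`, `gz`:
`a` is the signed number of crossings of `γ_w` with the edge, counted positively if the white
endpoint is on the left of `γ_w`, and likewise for `b`. -/
def exponent (gw gz : ℤ × ℤ) (e : E) : ℤ × ℤ := (wedge (D.disp e) gw, wedge (D.disp e) gz)

/-- The Kasteleyn matrix, with entries in the ring `ℂ[w^±1, z^±1]` of Laurent polynomials: the sum of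
the weights `c e * w ^ a * z ^ b` of all edges that join the two nodes. -/
def kasteleyn (gw gz : ℤ × ℤ) (c : E → ℂ) :
    Matrix D.White D.Black (AddMonoidAlgebra ℂ (ℤ × ℤ)) := fun v b =>
  ∑ e with D.white e = v ∧ D.black e = b, AddMonoidAlgebra.single (D.exponent gw gz e) (c e)

/-- The determinant of the Kasteleyn matrix. The bijection `φ` puts rows and columns in a common
order; it affects the determinant by a sign only. -/
def kasteleynDet (gw gz : ℤ × ℤ) (c : E → ℂ) (φ : D.White ≃ D.Black) :
    AddMonoidAlgebra ℂ (ℤ × ℤ) :=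
  ((D.kasteleyn gw gz c).submatrix id φ).det

end Dimer

/-- The Newton polygon of a Laurent polynomial in two variables. -/
def newtonPolygon (f : AddMonoidAlgebra ℂ (ℤ × ℤ)) : Set (ℝ × ℝ) :=
  convexHull ℝ (toReal '' (f.coeff.support : Set (ℤ × ℤ)))

/-- The toric diagram. -/
def Dimer.toricDiagram {E : Type*} [Fintype E] (D : Dimer E) (gw gz : ℤ × ℤ) (c : E → ℂ)
    (φ : D.White ≃ D.Black) : Set (ℝ × ℝ) :=
  newtonPolygon (D.kasteleynDet gw gz c φ)

/-- The segments that give rise to the `(p,q)`-legs of a lattice polygon `Δ`: `src` and `tgt` are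
consecutive lattice points on the boundary of `Δ`, in counterclockwise order (`Δ` lies on the left of
the directed line from `src` to `tgt`). -/
@[ext]
structure Leg (Δ : Set (ℝ × ℝ)) where
  src : ℤ × ℤ
  tgt : ℤ × ℤ
  src_mem : toReal src ∈ Δ
  tgt_mem : toReal tgt ∈ Δ
  ne : src ≠ tgt
  boundary : ∀ x ∈ Δ, 0 ≤ wedge (toReal tgt - toReal src) (x - toReal src)
  consecutive : ∀ p : ℤ × ℤ, toReal p ∈ segment ℝ (toReal src) (toReal tgt) → p = src ∨ p = tgt

/-- The leg `(p, q)` itself: the outward normal vector obtained by turning the boundary segment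
clockwise by 90 degrees. -/
def Leg.vec {Δ : Set (ℝ × ℝ)} (l : Leg Δ) : ℤ × ℤ := (l.tgt.2 - l.src.2, -(l.tgt.1 - l.src.1))

/-! ### The perfect matchings attached to rays -/

namespace Dimer

variable {E : Type*} [Fintype E] (D : Dimer E)

/-- A set of edges that contains exactly one edge at each node. -/
def IsPerfectMatching (M : Finset E) : Prop :=
  (∀ v : D.White, ∃! e, e ∈ M ∧ D.white e = v) ∧ (∀ b : D.Black, ∃! e, e ∈ M ∧ D.black e = b)

/-- The point of the toric diagram that belongs to a set of edges: the exponent of the product of the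
weights of its edges. -/
def point (gw gz : ℤ × ℤ) (M : Finset E) : ℤ × ℤ := ∑ e ∈ M, D.exponent gw gz e

/-- A winding, seen in the real plane. -/
def windingR (Z : D.ZigzagPath) : ℝ × ℝ := toReal (D.winding Z)

/-- The ray spanned by `r` does not have the direction of the winding of a zigzag path. -/
def IsGenericRay (r : ℝ × ℝ) : Prop := r ≠ 0 ∧ ∀ Z : D.ZigzagPath, ¬ SameDir r (D.windingR Z)

/-- Among the zigzag paths in `S`, none makes a smaller counterclockwise angle with `r` than `Z`. -/
def IsFirstCcw (r : ℝ × ℝ) (S : Set D.ZigzagPath) (Z : D.ZigzagPath) : Prop :=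
  ∀ Y ∈ S, ¬ Ccw r (D.windingR Y) (D.windingR Z)

/-- Among the zigzag paths in `S`, none makes a smaller clockwise angle with `r` than `Z`. -/
def IsFirstCw (r : ℝ × ℝ) (S : Set D.ZigzagPath) (Z : D.ZigzagPath) : Prop :=
  ∀ Y ∈ S, ¬ Ccw (D.windingR Z) (D.windingR Y) r

/-- The zigzag paths that pass through a white node. -/
def pathsAtWhite (v : D.White) : Set D.ZigzagPath := {Z | ∃ e, D.white e = v ∧ D.zigOut e = Z}

/-- The zigzag paths that pass through a black node. -/
def pathsAtBlack (b : D.Black) : Set D.ZigzagPath := {Z | ∃ e, D.black e = b ∧ D.zigIn e = Z}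

open Classical in
/-- The set `M(r)` of the edges chosen by the nodes. A node chooses its edge between the
two zigzag paths through the node whose windings make the smallest clockwise and the smallest
counterclockwise angle with `r`. Counterclockwise around either endpoint of an edge `e`, the path
`zigIn e` comes just before `e` and `zigOut e` just after. -/
def rayMatching (r : ℝ × ℝ) : Finset E :=
  {e | (D.IsFirstCw r (D.pathsAtWhite (D.white e)) (D.zigIn e) ∧
        D.IsFirstCcw r (D.pathsAtWhite (D.white e)) (D.zigOut e)) ∨
      (D.IsFirstCw r (D.pathsAtBlack (D.black e)) (D.zigIn e) ∧
        D.IsFirstCcw r (D.pathsAtBlack (D.black e)) (D.zigOut e))}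

end Dimer

end

/-!
Let `disp M` be the sum of the displacements of the edges of a perfect matching `M`. The exponents
in the Kasteleyn determinant are linear images `(x ∧ g_w, x ∧ g_z)` of the vectors `x = disp M`, so
the toric diagram is read off from the convex hull of these vectors.

By Poincaré duality on the torus, `winding Z ∧ disp M` is, up to a constant that does not depend on
the matching `M`, minus the number of edges of `M` on the zigzag path `Z`. A matching contains at
most half of the edges of `Z`, and a matching that contains every other edge of `Z` therefore lies
on the boundary of a half plane that contains the displacements of all matchings. The matching of a
ray contains such a half of both paths whose windings are next to the ray, so its displacement is
the apex of a cone and thus a corner. No other matching has the same displacement: otherwise some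
path would have one half in each of the two matchings, and exchanging halves would move the apex by
plus and minus the winding, at least once out of the cone. So the coefficient of this corner in the
determinant is a single nonzero term.

Turning the ray across the direction of a winding `w` exchanges the halves of the `n` paths of
winding `w`, which moves the corner by `n w`. Windings of simple closed paths are primitive, so this
edge of the polygon has exactly `n` legs.
-/

/-! ### The circular order of directions -/

section Wedge

variable {R : Type*} [CommRing R]

theorem wedge_swap (u v : R × R) : wedge v u = -wedge u v := by
  simp only [wedge]; ring

theorem wedge_self (u : R × R) : wedge u u = 0 := by
  simp only [wedge]; ring

theorem wedge_add_right (u v w : R × R) : wedge u (v + w) = wedge u v + wedge u w := by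
  simp only [wedge, Prod.fst_add, Prod.snd_add]; ring

theorem wedge_sub_right (u v w : R × R) : wedge u (v - w) = wedge u v - wedge u w := by
  simp only [wedge, Prod.fst_sub, Prod.snd_sub]; ring

theorem wedge_smul_right (c : R) (u v : R × R) : wedge u (c • v) = c * wedge u v := by
  simp only [wedge, Prod.smul_fst, Prod.smul_snd, smul_eq_mul]; ring

theorem wedge_sum_left {ι : Type*} (s : Finset ι) (f : ι → R × R) (v : R × R) :
    wedge (∑ i ∈ s, f i) v = ∑ i ∈ s, wedge (f i) v := by
  simp only [wedge, Prod.fst_sum, Prod.snd_sum, Finset.sum_mul, Finset.sum_sub_distrib]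

theorem wedge_sum_right {ι : Type*} (s : Finset ι) (f : ι → R × R) (v : R × R) :
    wedge v (∑ i ∈ s, f i) = ∑ i ∈ s, wedge v (f i) := by
  simp only [wedge, Prod.fst_sum, Prod.snd_sum, Finset.mul_sum, Finset.sum_sub_distrib]

theorem wedge_plucker (a b c d : R × R) :
    wedge a b * wedge c d + wedge a c * wedge d b + wedge a d * wedge b c = 0 := by
  simp only [wedge]; ring

theorem normSq_mul_wedge (u v w : R × R) :
    (u.1 * u.1 + u.2 * u.2) * wedge v w =
      (u.1 * v.1 + u.2 * v.2) * wedge u w - (u.1 * w.1 + u.2 * w.2) * wedge u v := by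
  simp only [wedge]; ring

theorem normSq_mul_dot (u v w : R × R) :
    (u.1 * u.1 + u.2 * u.2) * (v.1 * w.1 + v.2 * w.2) =
      (u.1 * v.1 + u.2 * v.2) * (u.1 * w.1 + u.2 * w.2) + wedge u v * wedge u w := by
  simp only [wedge]; ring

theorem eq_zero_of_wedge_eq_zero [IsDomain R] {u v x : R × R}
    (h : wedge u v ≠ 0) (hu : wedge u x = 0) (hv : wedge v x = 0) : x = 0 := by
  simp only [wedge] at *
  refine Prod.ext ?_ ?_
  · refine (mul_eq_zero.1 (?_ : (u.1 * v.2 - u.2 * v.1) * x.1 = 0)).resolve_left h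
    linear_combination v.1 * hu - u.1 * hv
  · refine (mul_eq_zero.1 (?_ : (u.1 * v.2 - u.2 * v.1) * x.2 = 0)).resolve_left h
    linear_combination v.2 * hu - u.2 * hv

theorem exists_eq_smul_of_wedge_eq_zero {u w : R × R} (hw : IsCoprime w.1 w.2)
    (h : wedge w u = 0) : ∃ t : R, u = t • w := by
  obtain ⟨a, b, hab⟩ := hw
  simp only [wedge] at h
  refine ⟨a * u.1 + b * u.2, Prod.ext ?_ ?_⟩
  · simp only [Prod.smul_fst, smul_eq_mul]
    linear_combination (-u.1) * hab - b * h
  · simp only [Prod.smul_snd, smul_eq_mul]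
    linear_combination (-u.2) * hab + a * h

end Wedge

section CircularOrder

variable {R : Type*} [CommRing R] [LinearOrder R] {r u v w : R × R}

theorem Ccw.rotate (h : Ccw u v w) : Ccw v w u := by
  unfold Ccw at *; tauto

theorem SameDir.symm (h : SameDir u v) : SameDir v u :=
  ⟨by rw [wedge_swap u v, h.1, neg_zero], by simpa only [mul_comm] using h.2⟩

variable [IsStrictOrderedRing R]

theorem Ccw.not_swap (h : Ccw u v w) : ¬ Ccw u w v := by
  unfold Ccw at *
  rw [wedge_swap v w, wedge_swap u v, wedge_swap w u]
  rintro (h' | h' | h') <;> rcases h with h | h | h <;> linarith [h.1, h.2, h'.1, h'.2]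

theorem not_ccw_self_right (u v : R × R) : ¬ Ccw u v v := fun h => h.not_swap h

theorem Ccw.trans (huv : Ccw r u v) (hvw : Ccw r v w) : Ccw r u w := by
  have plucker := wedge_plucker r u v w
  unfold Ccw at *
  rw [wedge_swap r v] at huv
  rw [wedge_swap r w] at hvw
  rw [wedge_swap r w, wedge_swap w u]
  rcases lt_trichotomy (wedge r v) 0 with hv | hv | hv
  · obtain ⟨hvw', hw⟩ : 0 < wedge v w ∧ 0 < -wedge r w := by grind
    rcases lt_or_ge 0 (wedge r u) with hu | hu
    · exact Or.inr (Or.inr ⟨hw, hu⟩)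
    · have huv' : 0 < wedge u v := by grind
      refine Or.inr (Or.inl ⟨?_, hw⟩)
      have := mul_nonpos_of_nonpos_of_nonneg hu hvw'.le
      have := mul_pos hw huv'
      exact neg_pos.2 (neg_of_mul_pos_right (by linarith) hv.le)
  · grind
  · obtain ⟨hu, huv'⟩ : 0 < wedge r u ∧ 0 < wedge u v := by grind
    rcases lt_or_ge (wedge r w) 0 with hw | hw
    · exact Or.inr (Or.inr ⟨neg_pos.2 hw, hu⟩)
    · have hvw' : 0 < wedge v w := by grind
      refine Or.inl ⟨hu, ?_⟩
      have := mul_pos hu hvw'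
      have := mul_nonneg hw huv'.le
      exact neg_pos.2 (neg_of_mul_neg_right (by linarith) hv.le)

theorem Ccw.trans_right (huv : Ccw r u v) (hvw : Ccw r v w) : Ccw u v w :=
  (Ccw.trans hvw.rotate huv.rotate.rotate).rotate.rotate

instance (r : R × R) : IsStrictOrder (R × R) (Ccw r) where
  irrefl := not_ccw_self_right r
  trans _ _ _ := Ccw.trans

theorem exists_first_ccw {ι : Type*} [Finite ι] (r : R × R) (V : ι → R × R) {S : Set ι}
    (hS : S.Nonempty) : ∃ i ∈ S, ∀ j ∈ S, ¬ Ccw r (V j) (V i) :=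
  (Finite.wellFounded_of_trans_of_irrefl (V ⁻¹'o Ccw r)).has_min S hS

theorem exists_last_ccw {ι : Type*} [Finite ι] (r : R × R) (V : ι → R × R) {S : Set ι}
    (hS : S.Nonempty) : ∃ i ∈ S, ∀ j ∈ S, ¬ Ccw r (V i) (V j) :=
  (Finite.wellFounded_of_trans_of_irrefl (V ⁻¹'o Function.swap (Ccw r))).has_min S hS

theorem normSq_pos (hu : u ≠ 0) : 0 < u.1 * u.1 + u.2 * u.2 := by
  have h₁ := mul_self_nonneg u.1
  have h₂ := mul_self_nonneg u.2
  refine lt_of_le_of_ne (by linarith) fun h => hu ?_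
  exact Prod.ext (mul_self_eq_zero.1 (by linarith)) (mul_self_eq_zero.1 (by linarith))

theorem Ccw.not_sameDir (h : Ccw u v w) : ¬ SameDir u w := by
  rintro ⟨huw, hdot⟩
  have hwu : wedge w u = 0 := by rw [wedge_swap, huw, neg_zero]
  obtain ⟨huv, hvw⟩ : 0 < wedge u v ∧ 0 < wedge v w := by
    unfold Ccw at h; rw [hwu] at h; simpa using h
  have key := normSq_mul_wedge u v w
  rw [huw, mul_zero, zero_sub] at key
  have := mul_pos hdot huv
  have := mul_nonneg (add_nonneg (mul_self_nonneg u.1) (mul_self_nonneg u.2)) hvw.le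
  linarith

theorem dot_neg_of_not_sameDir (hu : u ≠ 0) (hv : v ≠ 0) (huv : wedge u v = 0)
    (h : ¬ SameDir u v) : u.1 * v.1 + u.2 * v.2 < 0 := by
  refine lt_of_le_of_ne (not_lt.1 fun hdot => h ⟨huv, hdot⟩) fun hdot => ?_
  have lagrange := normSq_mul_dot u v v
  rw [hdot, huv, mul_zero, add_zero] at lagrange
  exact (mul_pos (normSq_pos hu) (normSq_pos hv)).ne' lagrange

theorem ccw_of_wedge_eq_zero (hu : u ≠ 0) (hv : v ≠ 0) (huv : wedge u v = 0)
    (h : ¬ SameDir u v) (hw : 0 < wedge w u) : Ccw u v w := by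
  have key := normSq_mul_wedge u v w
  rw [huv, mul_zero, sub_zero, wedge_swap w u] at key
  have := mul_pos_of_neg_of_neg (dot_neg_of_not_sameDir hu hv huv h) (neg_neg_of_pos hw)
  exact Or.inr (Or.inl ⟨pos_of_mul_pos_right (key ▸ this) (normSq_pos hu).le, hw⟩)

theorem ccw_or_ccw_of_wedge_eq_zero (hu : u ≠ 0) (hv : v ≠ 0) (hw : w ≠ 0)
    (huv' : wedge u v = 0) (huv : ¬ SameDir u v) (huw : ¬ SameDir u w) (hvw : ¬ SameDir v w) :
    Ccw u v w ∨ Ccw u w v := by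
  rcases lt_trichotomy (wedge w u) 0 with hwu | hwu | hwu
  · have hvu : wedge v u = 0 := by rw [wedge_swap, huv', neg_zero]
    have hwv : 0 < wedge w v := by
      have key := normSq_mul_wedge u w v
      rw [huv', mul_zero, zero_sub, wedge_swap w u, mul_neg, neg_neg] at key
      have := mul_pos_of_neg_of_neg (dot_neg_of_not_sameDir hu hv huv' huv) hwu
      exact pos_of_mul_pos_right (key ▸ this) (normSq_pos hu).le
    exact Or.inr (ccw_of_wedge_eq_zero hv hu hvu (huv ·.symm) hwv).rotate
  · have huw' : wedge u w = 0 := by rw [wedge_swap, hwu, neg_zero]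
    have hvw' := normSq_mul_wedge u v w
    have hdot := normSq_mul_dot u v w
    rw [huw', huv', mul_zero, mul_zero, sub_zero] at hvw'
    rw [huv', zero_mul, add_zero] at hdot
    have := mul_pos_of_neg_of_neg (dot_neg_of_not_sameDir hu hv huv' huv)
      (dot_neg_of_not_sameDir hu hw huw' huw)
    exact absurd ⟨(mul_eq_zero.1 hvw').resolve_left (normSq_pos hu).ne',
      pos_of_mul_pos_right (hdot ▸ this) (normSq_pos hu).le⟩ hvw
  · exact Or.inl (ccw_of_wedge_eq_zero hu hv huv' huv hwu)

theorem ccw_or_ccw_of_not_sameDir (hu : u ≠ 0) (hv : v ≠ 0) (hw : w ≠ 0)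
    (huv : ¬ SameDir u v) (huw : ¬ SameDir u w) (hvw : ¬ SameDir v w) :
    Ccw u v w ∨ Ccw u w v := by
  by_cases huv' : wedge u v = 0
  · exact ccw_or_ccw_of_wedge_eq_zero hu hv hw huv' huv huw hvw
  by_cases hvw' : wedge v w = 0
  · exact (ccw_or_ccw_of_wedge_eq_zero hv hw hu hvw' hvw (huv ·.symm) (huw ·.symm)).imp
      (·.rotate.rotate) (·.rotate)
  by_cases hwu' : wedge w u = 0
  · exact (ccw_or_ccw_of_wedge_eq_zero hw hu hv hwu' (huw ·.symm) (hvw ·.symm) huv).imp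
      (·.rotate) (·.rotate.rotate)
  unfold Ccw
  rw [wedge_swap w u, wedge_swap v w, wedge_swap u v]
  grind

theorem Ccw.wedge_pos (h : Ccw u v w) (huw : 0 ≤ wedge u w) :
    0 < wedge u v ∧ 0 < wedge v w := by
  have := wedge_swap u w
  unfold Ccw at h
  rcases h with h | h | h
  · exact h
  · linarith [h.2]
  · linarith [h.1]

end CircularOrder

theorem ne_zero_of_isCoprime {w : ℤ × ℤ} (hw : IsCoprime w.1 w.2) : w ≠ 0 := by
  rintro rfl
  exact not_isCoprime_zero_zero hw

theorem exists_nsmul_of_sameDir {u w : ℤ × ℤ} (hw : IsCoprime w.1 w.2) (h : SameDir w u) :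
    ∃ n : ℕ, u = n • w := by
  obtain ⟨t, rfl⟩ := exists_eq_smul_of_wedge_eq_zero hw h.1
  have dot_pos : 0 < t * (w.1 * w.1 + w.2 * w.2) := by
    have := h.2
    simp only [Prod.smul_fst, Prod.smul_snd, smul_eq_mul] at this
    linarith
  have ht := pos_of_mul_pos_left dot_pos (normSq_pos (ne_zero_of_isCoprime hw)).le
  lift t to ℕ using ht.le
  exact ⟨t, natCast_zsmul w t⟩

theorem eq_of_sameDir {u w : ℤ × ℤ} (hu : IsCoprime u.1 u.2) (hw : IsCoprime w.1 w.2)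
    (h : SameDir u w) : u = w := by
  obtain ⟨n, rfl⟩ := exists_nsmul_of_sameDir hu h
  rw [Prod.smul_fst, Prod.smul_snd, nsmul_eq_mul, nsmul_eq_mul] at hw
  have hn : IsUnit (n : ℤ) := hw.isRelPrime (dvd_mul_right _ u.1) (dvd_mul_right _ u.2)
  rw [Int.ofNat_isUnit, Nat.isUnit_iff] at hn
  rw [hn, one_smul]

/-! ### Lattice vectors in the real plane -/

theorem wedge_toReal (u v : ℤ × ℤ) : wedge (toReal u) (toReal v) = (wedge u v : ℤ) := by
  simp [wedge, toReal]

theorem sameDir_toReal {u v : ℤ × ℤ} : SameDir (toReal u) (toReal v) ↔ SameDir u v := by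
  unfold SameDir
  rw [wedge_toReal]
  simp only [toReal]
  norm_cast

theorem ccw_toReal {u v w : ℤ × ℤ} : Ccw (toReal u) (toReal v) (toReal w) ↔ Ccw u v w := by
  simp only [Ccw, wedge_toReal, Int.cast_pos]

theorem toReal_injective : Function.Injective toReal := fun u v h => by
  simp only [toReal, Prod.mk.injEq, Int.cast_inj] at h
  exact Prod.ext h.1 h.2

theorem toReal_ne_zero {u : ℤ × ℤ} (h : u ≠ 0) : toReal u ≠ 0 := fun h' =>
  h (toReal_injective (by rw [h']; ext <;> simp [toReal]))

theorem toReal_add (u v : ℤ × ℤ) : toReal (u + v) = toReal u + toReal v := by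
  simp [toReal]

theorem toReal_sub (u v : ℤ × ℤ) : toReal (u - v) = toReal u - toReal v := by
  simp [toReal]

theorem toReal_zsmul (n : ℤ) (u : ℤ × ℤ) : toReal (n • u) = (n : ℝ) • toReal u := by
  simp [toReal]

theorem perm_apply_inv {E : Type*} (f : Equiv.Perm E) (x : E) : f (f⁻¹ x) = x :=
  f.apply_symm_apply x

theorem perm_inv_apply {E : Type*} (f : Equiv.Perm E) (x : E) : f⁻¹ (f x) = x :=
  f.symm_apply_apply x

theorem exists_pow_lt_minimalPeriod_of_sameCycle {E : Type*} [Finite E] {ρ : Equiv.Perm E}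
    {e e' : E} (h : ρ.SameCycle e e') : ∃ k < Function.minimalPeriod ρ e, (ρ ^ k) e = e' := by
  obtain ⟨k, hk⟩ := h.exists_nat_pow_eq
  have hpos : 0 < Function.minimalPeriod ρ e :=
    Function.minimalPeriod_pos_of_mem_periodicPts (ρ.injective.mem_periodicPts e)
  refine ⟨k % Function.minimalPeriod ρ e, Nat.mod_lt _ hpos, ?_⟩
  rw [← Equiv.Perm.iterate_eq_pow, Function.iterate_mod_minimalPeriod_eq,
    Equiv.Perm.iterate_eq_pow, hk]

/-! ### The perfect matchings of rays -/

/-- The vectors `V` along each orbit of `ρ` are in the circular order, their directions are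
distinct, and each orbit has at least two elements. For a node of a dimer, `ρ` is the rotation of
the edges and `V e` the winding of the zigzag path in a corner at `e`. -/
structure CyclicallyOrdered {E R : Type*} [CommRing R] [LinearOrder R] (ρ : Equiv.Perm E)
    (V : E → R × R) : Prop where
  vec_ne_zero : ∀ e, V e ≠ 0
  apply_ne : ∀ e, ρ e ≠ e
  not_sameDir : ∀ e e', ρ.SameCycle e e' → e ≠ e' → ¬ SameDir (V e) (V e')
  ccw : ∀ e e', ρ.SameCycle e e' → e' ≠ e → e' ≠ ρ e → Ccw (V e) (V (ρ e)) (V e')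

namespace CyclicallyOrdered

variable {E R : Type*} [CommRing R] [LinearOrder R] {ρ : Equiv.Perm E} {V : E → R × R}

theorem not_sameDir_apply (h : CyclicallyOrdered ρ V) (e : E) : ¬ SameDir (V e) (V (ρ e)) :=
  h.not_sameDir e (ρ e) (Equiv.Perm.SameCycle.refl ρ e).apply_right (h.apply_ne e).symm

variable [IsStrictOrderedRing R] {r : R × R}

theorem ccw_or_ccw (h : CyclicallyOrdered ρ V) (hr : r ≠ 0) (hrV : ∀ e, ¬ SameDir r (V e))
    {e e' : E} (hs : ρ.SameCycle e e') (hne : e ≠ e') :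
    Ccw r (V e) (V e') ∨ Ccw r (V e') (V e) :=
  ccw_or_ccw_of_not_sameDir hr (h.vec_ne_zero e) (h.vec_ne_zero e') (hrV e) (hrV e')
    (h.not_sameDir e e' hs hne)

theorem not_ccw_of_ccw_apply (h : CyclicallyOrdered ρ V) {e y : E} (hs : ρ.SameCycle e y)
    (hr : Ccw (V e) r (V (ρ e))) : ¬ Ccw (V e) (V y) r ∧ ¬ Ccw r (V y) (V (ρ e)) := by
  by_cases hy : y = e
  · subst hy
    exact ⟨fun hc => hc.rotate.rotate.not_swap hc.rotate.rotate, fun hc => hc.not_swap hr.rotate⟩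
  by_cases hy' : y = ρ e
  · subst hy'
    exact ⟨fun hc => hc.not_swap hr, not_ccw_self_right _ _⟩
  have hnot : ¬ Ccw (V (ρ e)) (V e) (V y) := (h.ccw e y hs hy hy').rotate.not_swap
  exact ⟨fun hc => hnot (hr.rotate.trans_right hc.rotate.rotate),
    fun hc => hnot (hc.trans_right hr.rotate).rotate⟩

theorem existsUnique_ccw [Finite E] (h : CyclicallyOrdered ρ V) (hr : r ≠ 0)
    (hrV : ∀ e, ¬ SameDir r (V e)) (e₀ : E) :
    ∃! e, ρ.SameCycle e₀ e ∧ Ccw (V e) r (V (ρ e)) := by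
  obtain ⟨e, (he : ρ.SameCycle e₀ e), hlast⟩ :=
    exists_last_ccw r V (S := {e | ρ.SameCycle e₀ e}) ⟨e₀, .refl _ _⟩
  refine ⟨e, ⟨he, ?_⟩, ?_⟩
  · have := h.ccw_or_ccw hr hrV (Equiv.Perm.SameCycle.refl ρ e).apply_right (h.apply_ne e).symm
    exact (this.resolve_left (hlast _ he.apply_right)).rotate.rotate
  · rintro e' ⟨he', hc⟩
    by_contra hne
    rcases h.ccw_or_ccw hr hrV (he'.symm.trans he) hne with hcw | hcw
    · exact (h.not_ccw_of_ccw_apply (he'.symm.trans he) hc).1 hcw.rotate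
    · exact hlast _ he' hcw

end CyclicallyOrdered

namespace Dimer

variable {E : Type*} [Fintype E] {D : Dimer E}

theorem OrderedAround.not_sameDir {ρ : Equiv.Perm E} {P : E → D.ZigzagPath} {e e' : E}
    (h : D.OrderedAround ρ P e) (hs : ρ.SameCycle e e') (hne : e ≠ e') :
    ¬ SameDir (D.windingR (P e)) (D.windingR (P e')) := by
  obtain ⟨k, hk, rfl⟩ := exists_pow_lt_minimalPeriod_of_sameCycle hs
  have hk0 : 0 < k := Nat.pos_of_ne_zero fun h0 => hne (by simp [h0])
  simpa only [windingR, sameDir_toReal, pow_zero, Equiv.Perm.coe_one, id_eq] using h.1 0 k hk0 hk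

theorem OrderedAround.ccw {ρ : Equiv.Perm E} {P : E → D.ZigzagPath} {e e' : E}
    (h : D.OrderedAround ρ P e) (hs : ρ.SameCycle e e') (hne : e' ≠ e) (hne' : e' ≠ ρ e) :
    Ccw (D.windingR (P e)) (D.windingR (P (ρ e))) (D.windingR (P e')) := by
  obtain ⟨k, hk, rfl⟩ := exists_pow_lt_minimalPeriod_of_sameCycle hs
  have hk0 : k ≠ 0 := fun h0 => hne (by simp [h0])
  have hk1 : k ≠ 1 := fun h1 => hne' (by simp [h1])
  simpa only [windingR, ccw_toReal, pow_zero, pow_one, Equiv.Perm.coe_one, id_eq] using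
    h.2 0 1 k one_pos (by omega) hk

section Nodes

variable (D)

theorem zigOut_eq_zigOut {e e' : E} :
    D.zigOut e = D.zigOut e' ↔ D.zigzagPerm.SameCycle e e' := Quotient.eq

theorem white_eq_white {e e' : E} : D.white e = D.white e' ↔ D.rotW.SameCycle e e' := Quotient.eq

theorem black_eq_black {e e' : E} : D.black e = D.black e' ↔ D.rotB.SameCycle e e' := Quotient.eq

theorem white_rotW (e : E) : D.white (D.rotW e) = D.white e :=
  D.white_eq_white.2 (Equiv.Perm.SameCycle.refl _ _).apply_left

theorem black_rotB (e : E) : D.black (D.rotB e) = D.black e :=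
  D.black_eq_black.2 (Equiv.Perm.SameCycle.refl _ _).apply_left

theorem white_rotW_inv (e : E) : D.white (D.rotW⁻¹ e) = D.white e := by
  rw [← white_rotW, perm_apply_inv]

theorem black_rotB_inv (e : E) : D.black (D.rotB⁻¹ e) = D.black e := by
  rw [← black_rotB, perm_apply_inv]

theorem zigOut_rotB_inv (e : E) : D.zigOut (D.rotB⁻¹ e) = D.zigIn e := by
  have hstep : D.zigzagPerm (D.rotW⁻¹ e) = D.rotB⁻¹ e := by
    rw [zigzagPerm, Equiv.Perm.mul_apply, perm_apply_inv]
  exact D.zigOut_eq_zigOut.2 (hstep ▸ (Equiv.Perm.SameCycle.refl _ _).apply_left)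

theorem zigOut_rotW_inv (e : E) : D.zigOut (D.rotW⁻¹ e) = D.zigIn e := rfl

theorem zigIn_rotW (e : E) : D.zigIn (D.rotW e) = D.zigOut e := by
  rw [← zigOut_rotW_inv, perm_inv_apply]

theorem zigIn_rotB (e : E) : D.zigIn (D.rotB e) = D.zigOut e := by
  rw [← zigOut_rotB_inv, perm_inv_apply]

theorem white_surjective : Function.Surjective D.white := Quotient.mk_surjective

theorem black_surjective : Function.Surjective D.black := Quotient.mk_surjective

theorem zigOut_surjective : Function.Surjective D.zigOut := Quotient.mk_surjective

end Nodes

namespace ProperlyOrdered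

theorem windingR_ne_zero (hD : D.ProperlyOrdered) (Z : D.ZigzagPath) : D.windingR Z ≠ 0 :=
  toReal_ne_zero (hD.winding_ne_zero Z)

theorem zigIn_ne_zigOut (hD : D.ProperlyOrdered) (e : E) : D.zigIn e ≠ D.zigOut e := fun h =>
  hD.winding_ne e (by rw [h])

theorem cyclicallyOrdered_white (hD : D.ProperlyOrdered) :
    CyclicallyOrdered D.rotW fun e => D.windingR (D.zigOut e) where
  vec_ne_zero e := hD.windingR_ne_zero _
  apply_ne e h := hD.zigIn_ne_zigOut e (by rw [← D.zigIn_rotW, h])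
  not_sameDir e _ hs hne := (hD.white_ordered e).not_sameDir hs hne
  ccw e _ hs hne hne' := (hD.white_ordered e).ccw hs hne hne'

theorem cyclicallyOrdered_black (hD : D.ProperlyOrdered) :
    CyclicallyOrdered D.rotB fun e => D.windingR (D.zigIn e) where
  vec_ne_zero e := hD.windingR_ne_zero _
  apply_ne e h := hD.zigIn_ne_zigOut e (by rw [← D.zigIn_rotB, h])
  not_sameDir e _ hs hne := (hD.black_ordered e).not_sameDir hs hne
  ccw e _ hs hne hne' := (hD.black_ordered e).ccw hs hne hne'

theorem not_sameDir (hD : D.ProperlyOrdered) (e : E) :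
    ¬ SameDir (D.windingR (D.zigIn e)) (D.windingR (D.zigOut e)) := by
  simpa only [zigIn_rotB] using hD.cyclicallyOrdered_black.not_sameDir_apply e

variable {r : ℝ × ℝ}

theorem ccw_or_ccw (hD : D.ProperlyOrdered) (hr : D.IsGenericRay r) {Y Z : D.ZigzagPath}
    (h : ¬ SameDir (D.windingR Y) (D.windingR Z)) :
    Ccw r (D.windingR Y) (D.windingR Z) ∨ Ccw r (D.windingR Z) (D.windingR Y) :=
  ccw_or_ccw_of_not_sameDir hr.1 (hD.windingR_ne_zero _) (hD.windingR_ne_zero _) (hr.2 _) (hr.2 _) h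

theorem mem_rayMatching (hD : D.ProperlyOrdered) (hr : D.IsGenericRay r) {e : E} :
    e ∈ D.rayMatching r ↔ Ccw (D.windingR (D.zigIn e)) r (D.windingR (D.zigOut e)) := by
  simp only [rayMatching, Finset.mem_filter, Finset.mem_univ, true_and]
  constructor
  · have ccw_of_isFirstCcw (S : Set D.ZigzagPath) (hS : D.zigIn e ∈ S)
        (h : D.IsFirstCcw r S (D.zigOut e)) :
        Ccw (D.windingR (D.zigIn e)) r (D.windingR (D.zigOut e)) :=
      ((hD.ccw_or_ccw hr (hD.not_sameDir e)).resolve_left (h _ hS)).rotate.rotate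
    rintro (h | h)
    · exact ccw_of_isFirstCcw (D.pathsAtWhite (D.white e)) ⟨_, D.white_rotW_inv e, rfl⟩ h.2
    · exact ccw_of_isFirstCcw (D.pathsAtBlack (D.black e)) ⟨e, rfl, rfl⟩ h.2
  · intro h
    rw [← zigIn_rotB] at h ⊢
    have hfirst {y : E} (hy : D.black y = D.black e) :=
      hD.cyclicallyOrdered_black.not_ccw_of_ccw_apply (D.black_eq_black.1 hy.symm) h
    refine Or.inr ⟨?_, ?_⟩
    · rintro _ ⟨y, hy, rfl⟩
      exact (hfirst hy).1
    · rintro _ ⟨y, hy, rfl⟩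
      exact (hfirst hy).2

theorem isPerfectMatching_rayMatching (hD : D.ProperlyOrdered) (hr : D.IsGenericRay r) :
    D.IsPerfectMatching (D.rayMatching r) := by
  constructor
  · intro v
    obtain ⟨e₀, rfl⟩ := D.white_surjective v
    obtain ⟨e, ⟨he, hc⟩, huniq⟩ :=
      hD.cyclicallyOrdered_white.existsUnique_ccw hr.1 (fun e => hr.2 _) e₀
    refine ⟨D.rotW e, ⟨(hD.mem_rayMatching hr).2 (by rwa [zigIn_rotW]), ?_⟩, ?_⟩
    · rw [white_rotW, D.white_eq_white.2 he]
    · rintro e' ⟨hmem, hwhite⟩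
      have hc' := (hD.mem_rayMatching hr).1 hmem
      rw [← huniq (D.rotW⁻¹ e') ⟨D.white_eq_white.1 (by rw [white_rotW_inv, hwhite]), by
        simpa only [zigOut_rotW_inv, perm_apply_inv] using hc'⟩, perm_apply_inv]
  · intro b
    obtain ⟨e₀, rfl⟩ := D.black_surjective b
    simpa only [mem_rayMatching hD hr, black_eq_black, zigIn_rotB, and_comm,
      Equiv.Perm.sameCycle_comm (x := e₀)] using
      hD.cyclicallyOrdered_black.existsUnique_ccw hr.1 (fun e => hr.2 _) e₀

end ProperlyOrdered

end Dimer

/-! ### Cellular cohomology of the torus -/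

namespace Dimer

variable {E : Type*} [Fintype E] (D : Dimer E)

theorem forall_of_invariant {P : E → Prop} (hW : ∀ e, P (D.rotW e) ↔ P e)
    (hB : ∀ e, P (D.rotB e) ↔ P e) {e : E} (he : P e) (e' : E) : P e' := by
  have := D.connected
  obtain ⟨⟨g, hg⟩, rfl⟩ := MulAction.exists_smul_eq (Subgroup.closure {D.rotW, D.rotB}) e e'
  have invariant : ∀ a, P (g a) ↔ P a := by
    induction hg using Subgroup.closure_induction with
    | mem x hx =>
      rcases hx with rfl | rfl
      · exact hW
      · exact hB
    | one => exact fun a => Iff.rfl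
    | mul x y _ _ hx hy => exact fun a => by rw [Equiv.Perm.mul_apply, hx, hy]
    | inv x _ hx => exact fun a => by rw [← hx, perm_apply_inv]
  exact (invariant e).2 he

/-- The coboundary of a function on the nodes, on the edges oriented from white to black. -/
def coboundary {A : Type*} [AddCommGroup A] (g : D.White → A) (g' : D.Black → A) (e : E) : A :=
  g' (D.black e) - g (D.white e)

section Cochains

variable {R : Type*} [CommRing R]

/-- The function `x` on the edges, seen as the corners at the white nodes of the faces to the left
of the edges, is a primitive of the cochain `α` along the boundary of every face. -/
def IsPrimitive (x α : E → R) : Prop :=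
  ∀ e, x (facePerm D.rotW D.rotB e) = x e + α e - α (D.rotB⁻¹ e)

/-- The jumps across the edges of the primitive `x` of a cochain. They form a cycle, which is
Poincaré dual to the cochain. -/
def jump (x : E → R) (e : E) : R := x e - x (D.rotW⁻¹ e)

/-- The pairing of cochains with the cycle of jumps of `x`. If `x` and `y` are primitives of `α` and
`β`, then `pairing x β` is the intersection number of the classes of `α` and `β`. -/
def pairing (x : E → R) : (E → R) →ₗ[R] R := ∑ e, D.jump x e • LinearMap.proj e

theorem pairing_apply (x β : E → R) : D.pairing x β = ∑ e, D.jump x e * β e := by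
  simp only [pairing, LinearMap.sum_apply, LinearMap.smul_apply, LinearMap.proj_apply, smul_eq_mul]

theorem isPrimitive_coboundary (g : D.White → R) (g' : D.Black → R) :
    D.IsPrimitive (fun e => g (D.white e)) (D.coboundary g g') := fun e => by
  simp only [facePerm, Equiv.Perm.mul_apply, white_rotW_inv, coboundary, black_rotB_inv]
  ring

variable {D} {x α y β : E → R}

namespace IsPrimitive

theorem add (hx : D.IsPrimitive x α) (hy : D.IsPrimitive y β) :
    D.IsPrimitive (x + y) (α + β) := fun e => by
  simp only [Pi.add_apply, hx e, hy e]
  ring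

theorem smul (hx : D.IsPrimitive x α) (c : R) : D.IsPrimitive (c • x) (c • α) := fun e => by
  simp only [Pi.smul_apply, smul_eq_mul, hx e]
  ring

theorem jump_eq (hx : D.IsPrimitive x α) (e : E) :
    D.jump x e = (x e + α e) - (x (D.rotB e) + α (D.rotB e)) := by
  have := hx (D.rotB e)
  rw [facePerm, Equiv.Perm.mul_apply, perm_inv_apply] at this
  rw [jump, this]
  ring

theorem pairing_eq_sum (hx : D.IsPrimitive x α) (β : E → R) :
    D.pairing x β = ∑ e, (x e + α e) * (β e - β (D.rotB⁻¹ e)) := by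
  have reindex := Equiv.sum_comp D.rotB fun e => (x e + α e) * β (D.rotB⁻¹ e)
  simp only [perm_inv_apply] at reindex
  simp only [pairing_apply, hx.jump_eq, sub_mul, mul_sub, Finset.sum_sub_distrib, reindex]

theorem pairing_coboundary (hx : D.IsPrimitive x α) (g : D.White → R) (g' : D.Black → R) :
    D.pairing x (D.coboundary g g') = 0 := by
  have black_part : ∑ e, D.jump x e * g' (D.black e) = 0 := by
    rw [← pairing_apply D x fun e => g' (D.black e), hx.pairing_eq_sum]
    simp only [black_rotB_inv, sub_self, mul_zero, Finset.sum_const_zero]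
  have reindex := Equiv.sum_comp D.rotW fun e => x (D.rotW⁻¹ e) * g (D.white e)
  simp only [perm_inv_apply, white_rotW] at reindex
  simp only [pairing_apply, coboundary, mul_sub, Finset.sum_sub_distrib, black_part]
  simp only [jump, sub_mul, Finset.sum_sub_distrib, reindex, sub_self]

theorem pairing_swap (hx : D.IsPrimitive x α) (hy : D.IsPrimitive y β) :
    D.pairing x β = -D.pairing y α := by
  have sum_xy := Equiv.sum_comp (facePerm D.rotW D.rotB) fun e => x e * y e
  have sum_αβ := Equiv.sum_comp D.rotB⁻¹ fun e => α e * β e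
  rw [hx.pairing_eq_sum, hy.pairing_eq_sum, eq_neg_iff_add_eq_zero, ← Finset.sum_add_distrib]
  calc ∑ e, ((x e + α e) * (β e - β (D.rotB⁻¹ e)) + (y e + β e) * (α e - α (D.rotB⁻¹ e)))
      = ∑ e, ((x (facePerm D.rotW D.rotB e) * y (facePerm D.rotW D.rotB e) - x e * y e) +
          (α e * β e - α (D.rotB⁻¹ e) * β (D.rotB⁻¹ e))) :=
        Finset.sum_congr rfl fun e _ => by rw [hx e, hy e]; ring
    _ = 0 := by
        rw [Finset.sum_add_distrib, Finset.sum_sub_distrib, Finset.sum_sub_distrib, sum_xy, sum_αβ,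
          sub_self, sub_self, add_zero]

theorem pairing_self [IsAddTorsionFree R] (hx : D.IsPrimitive x α) : D.pairing x α = 0 :=
  self_eq_neg.1 (hx.pairing_swap hx)

end IsPrimitive

end Cochains

/-- The first component of the displacement, as a cochain. -/
def dispX (e : E) : ℝ := (D.disp e).1

/-- The second component of the displacement, as a cochain. -/
def dispY (e : E) : ℝ := (D.disp e).2

theorem exists_isPrimitive_disp : ∃ x y : E → ℝ,
    (D.IsPrimitive x D.dispX ∧ D.pairing x D.dispX = 0 ∧ D.pairing x D.dispY = 1) ∧
    (D.IsPrimitive y D.dispY ∧ D.pairing y D.dispX = -1 ∧ D.pairing y D.dispY = 0) := by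
  obtain ⟨z, hz, harea⟩ := D.toral
  set x : E → ℝ := fun e => (z e).1 with x_def
  set y : E → ℝ := fun e => (z e).2 with y_def
  have hx : D.IsPrimitive x D.dispX := fun e => by simp [x_def, hz e, dispX]
  have hy : D.IsPrimitive y D.dispY := fun e => by simp [y_def, hz e, dispY]
  have area : D.pairing x D.dispY - D.pairing y D.dispX = 2 := by
    rw [hx.pairing_eq_sum, hy.pairing_eq_sum, ← Finset.sum_sub_distrib]
    have harea' := congrArg (Int.cast : ℤ → ℝ) harea
    push_cast at harea'
    rw [← harea']
    refine Finset.sum_congr rfl fun e _ => ?_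
    simp only [x_def, y_def, hz e, wedge, dispX, dispY, Prod.fst_add, Prod.snd_add, Prod.fst_sub,
      Prod.snd_sub]
    push_cast
    ring
  have swap := hx.pairing_swap hy
  exact ⟨x, y, ⟨hx, hx.pairing_self, by linarith⟩, hy, by linarith, hy.pairing_self⟩

theorem nonempty_edge {E : Type*} [Fintype E] (D : Dimer E) : Nonempty E := by
  obtain ⟨x, -, ⟨-, -, pairing_eq_one⟩, -⟩ := D.exists_isPrimitive_disp
  by_contra hE
  rw [not_nonempty_iff] at hE
  simp [pairing_apply] at pairing_eq_one

/-- The faces: the orbits of the permutation that follows the boundaries of the faces. -/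
def Face : Type _ := Quotient (Equiv.Perm.SameCycle.setoid (facePerm D.rotW D.rotB))

/-- The face to the left of an edge. -/
def face (e : E) : D.Face :=
  Quotient.mk (Equiv.Perm.SameCycle.setoid (facePerm D.rotW D.rotB)) e

instance : Finite D.Face := inferInstanceAs (Finite (Quotient _))

noncomputable instance : Fintype D.Face := Fintype.ofFinite _

noncomputable instance : DecidableEq D.Face := Classical.decEq _

theorem face_surjective : Function.Surjective D.face := Quotient.mk_surjective

theorem face_facePerm (e : E) : D.face (facePerm D.rotW D.rotB e) = D.face e :=
  Quotient.sound (s := Equiv.Perm.SameCycle.setoid (facePerm D.rotW D.rotB))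
    (Equiv.Perm.SameCycle.refl _ _).apply_left

/-- The integrals of a cochain over the boundaries of the faces. The boundary of a face follows
each edge `e` on its left forwards and the edge `rotB⁻¹ e` backwards. -/
noncomputable def faceIntegral : (E → ℝ) →ₗ[ℝ] (D.Face → ℝ) where
  toFun α := ∑ e, (α e - α (D.rotB⁻¹ e)) • Pi.single (D.face e) 1
  map_add' α β := by
    simp only [Pi.add_apply, ← Finset.sum_add_distrib, ← add_smul, add_sub_add_comm]
  map_smul' c α := by
    simp only [Pi.smul_apply, smul_eq_mul, RingHom.id_apply, Finset.smul_sum, smul_smul, mul_sub]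

theorem faceIntegral_apply (α : E → ℝ) :
    D.faceIntegral α = ∑ e, (α e - α (D.rotB⁻¹ e)) • Pi.single (D.face e) 1 := rfl

theorem faceIntegral_single [DecidableEq E] (e : E) :
    D.faceIntegral (Pi.single e 1) = Pi.single (D.face e) 1 - Pi.single (D.face (D.rotB e)) 1 := by
  have reindex := Equiv.sum_comp D.rotB fun e' =>
    (Pi.single e 1 : E → ℝ) (D.rotB⁻¹ e') • (Pi.single (D.face e') 1 : D.Face → ℝ)
  simp only [perm_inv_apply] at reindex
  simp only [faceIntegral_apply, sub_smul, Finset.sum_sub_distrib, ← reindex]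
  simp [Pi.single_apply, ite_smul]

variable {D} in
theorem IsPrimitive.faceIntegral_eq_zero {x α : E → ℝ} (hx : D.IsPrimitive x α) :
    D.faceIntegral α = 0 := by
  have reindex := Equiv.sum_comp (facePerm D.rotW D.rotB) fun e =>
    x e • (Pi.single (D.face e) 1 : D.Face → ℝ)
  simp only [face_facePerm] at reindex
  have difference (e : E) : α e - α (D.rotB⁻¹ e) = x (facePerm D.rotW D.rotB e) - x e := by
    rw [hx e]
    ring
  simp only [faceIntegral_apply, difference, sub_smul, Finset.sum_sub_distrib, reindex, sub_self]

theorem single_face_sub_mem_range (e e' : E) :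
    Pi.single (D.face e') 1 - Pi.single (D.face e) 1 ∈ LinearMap.range D.faceIntegral := by
  classical
  have mem_iff_rotB (e' : E) :
      Pi.single (D.face (D.rotB e')) 1 - Pi.single (D.face e) 1 ∈ LinearMap.range D.faceIntegral ↔
        Pi.single (D.face e') 1 - Pi.single (D.face e) 1 ∈ LinearMap.range D.faceIntegral := by
    have := LinearMap.mem_range_self D.faceIntegral (Pi.single e' 1)
    rw [faceIntegral_single] at this
    rw [← Submodule.add_mem_iff_right _ this, sub_add_sub_cancel]
  refine D.forall_of_invariant (P := fun e' =>
    Pi.single (D.face e') 1 - Pi.single (D.face e) 1 ∈ LinearMap.range D.faceIntegral)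
    (fun e' => ?_) mem_iff_rotB (e := e) (by rw [sub_self]; exact zero_mem _) e'
  have face_eq := D.face_facePerm (D.rotB (D.rotW e'))
  rw [facePerm, Equiv.Perm.mul_apply, perm_inv_apply, perm_inv_apply] at face_eq
  rw [face_eq, mem_iff_rotB]

theorem card_face_le : Nat.card D.Face ≤ Module.finrank ℝ (LinearMap.range D.faceIntegral) + 1 := by
  obtain ⟨e₀⟩ := D.nonempty_edge
  have spanning : (⊤ : Submodule ℝ (D.Face → ℝ)) ≤
      LinearMap.range D.faceIntegral ⊔ ℝ ∙ Pi.single (D.face e₀) 1 := by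
    rw [← (Pi.basisFun ℝ D.Face).span_eq, Submodule.span_le]
    rintro _ ⟨f, rfl⟩
    obtain ⟨e, rfl⟩ := D.face_surjective f
    exact Submodule.mem_sup.2 ⟨_, D.single_face_sub_mem_range e₀ e, _,
      Submodule.mem_span_singleton_self _, by rw [Pi.basisFun_apply, sub_add_cancel]⟩
  calc Nat.card D.Face = Module.finrank ℝ (⊤ : Submodule ℝ (D.Face → ℝ)) := by
        rw [finrank_top, Module.finrank_fintype_fun_eq_card, Nat.card_eq_fintype_card]
    _ ≤ _ := Submodule.finrank_mono spanning
    _ ≤ _ := Submodule.finrank_add_le_finrank_add_finrank _ _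
    _ ≤ _ := add_le_add_right ((finrank_span_le_card _).trans (by simp)) _

/-- The coboundary of a function on the nodes, plus a combination of the displacements. -/
def coboundaryAddDisp : ((D.White → ℝ) × (D.Black → ℝ)) × ℝ × ℝ →ₗ[ℝ] (E → ℝ) where
  toFun t := D.coboundary t.1.1 t.1.2 + (t.2.1 • D.dispX + t.2.2 • D.dispY)
  map_add' t t' := by ext e; simp [coboundary]; ring
  map_smul' c t := by ext e; simp [coboundary]; ring

theorem coboundaryAddDisp_apply (g : D.White → ℝ) (g' : D.Black → ℝ) (a b : ℝ) :
    D.coboundaryAddDisp ((g, g'), a, b) = D.coboundary g g' + (a • D.dispX + b • D.dispY) := rfl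

variable {D} in
theorem IsPrimitive.pairing_coboundaryAddDisp {z α : E → ℝ} (hz : D.IsPrimitive z α)
    (g : D.White → ℝ) (g' : D.Black → ℝ) (a b : ℝ) :
    D.pairing z (D.coboundaryAddDisp ((g, g'), a, b)) =
      a * D.pairing z D.dispX + b * D.pairing z D.dispY := by
  simp only [coboundaryAddDisp_apply, map_add, map_smul, hz.pairing_coboundary, zero_add,
    smul_eq_mul]

theorem finrank_ker_coboundaryAddDisp :
    Module.finrank ℝ (LinearMap.ker D.coboundaryAddDisp) ≤ 1 := by
  obtain ⟨x, y, ⟨hx, hxx, hxy⟩, hy, hyx, hyy⟩ := D.exists_isPrimitive_disp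
  obtain ⟨e₀⟩ := D.nonempty_edge
  let constant : ((D.White → ℝ) × (D.Black → ℝ)) × ℝ × ℝ := ((1, 1), 0, 0)
  suffices LinearMap.ker D.coboundaryAddDisp ≤ ℝ ∙ constant from
    (Submodule.finrank_mono this).trans ((finrank_span_le_card _).trans (by simp))
  rintro ⟨⟨g, g'⟩, a, b⟩ hker
  rw [LinearMap.mem_ker] at hker
  obtain rfl : b = 0 := by
    simpa [hker, hxx, hxy, eq_comm] using hx.pairing_coboundaryAddDisp g g' a b
  obtain rfl : a = 0 := by
    simpa [hker, hyx, hyy, eq_comm] using hy.pairing_coboundaryAddDisp g g' a 0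
  have black_eq_white (e : E) : g' (D.black e) = g (D.white e) := by
    simpa [coboundaryAddDisp_apply, coboundary, sub_eq_zero] using congrFun hker e
  have white_const (e : E) : g (D.white e) = g (D.white e₀) :=
    D.forall_of_invariant (P := fun e => g (D.white e) = g (D.white e₀))
      (fun e => by rw [white_rotW])
      (fun e => by rw [← black_eq_white, black_rotB, black_eq_white]) rfl e
  refine Submodule.mem_span_singleton.2 ⟨g (D.white e₀), ?_⟩
  simp only [constant, Prod.smul_mk, smul_zero, Prod.mk.injEq, and_true]
  constructor
  · ext v
    obtain ⟨e, rfl⟩ := D.white_surjective v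
    simp [white_const e]
  · ext v
    obtain ⟨e, rfl⟩ := D.black_surjective v
    simp [black_eq_white, white_const e]

/-- This is where the Euler characteristic enters: it leaves no room for cohomology classes other
than the combinations of the two components of the displacement. -/
theorem range_coboundaryAddDisp :
    LinearMap.range D.coboundaryAddDisp = LinearMap.ker D.faceIntegral := by
  obtain ⟨x, y, ⟨hx, -⟩, hy, -⟩ := D.exists_isPrimitive_disp
  refine Submodule.eq_of_le_of_finrank_le ?_ ?_
  · rintro _ ⟨⟨⟨g, g'⟩, a, b⟩, rfl⟩
    exact ((D.isPrimitive_coboundary g g').add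
      ((hx.smul a).add (hy.smul b))).faceIntegral_eq_zero
  · have rank_nullity := LinearMap.finrank_range_add_finrank_ker D.coboundaryAddDisp
    have rank_nullity' := LinearMap.finrank_range_add_finrank_ker D.faceIntegral
    have ker_le := D.finrank_ker_coboundaryAddDisp
    have face_le := D.card_face_le
    have euler : Nat.card D.White + Nat.card D.Black + Nat.card D.Face = Fintype.card E := D.euler
    simp only [Module.finrank_prod, Module.finrank_fintype_fun_eq_card, Module.finrank_self,
      ← Nat.card_eq_fintype_card] at rank_nullity rank_nullity' euler
    omega

theorem IsPrimitive.exists_eq_add_coboundary {D : Dimer E} {z α : E → ℝ}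
    (hz : D.IsPrimitive z α) : ∃ (g : D.White → ℝ) (g' : D.Black → ℝ),
      α = D.pairing z D.dispY • D.dispX - D.pairing z D.dispX • D.dispY + D.coboundary g g' := by
  obtain ⟨x, y, ⟨hx, hxx, hxy⟩, hy, hyx, hyy⟩ := D.exists_isPrimitive_disp
  obtain ⟨⟨⟨g, g'⟩, a, b⟩, rfl⟩ : α ∈ LinearMap.range D.coboundaryAddDisp :=
    D.range_coboundaryAddDisp ▸ LinearMap.mem_ker.2 hz.faceIntegral_eq_zero
  have hb : D.pairing z D.dispX = -b := by
    rw [hz.pairing_swap hx, hx.pairing_coboundaryAddDisp, hxx, hxy, mul_zero, mul_one, zero_add]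
  have ha : D.pairing z D.dispY = a := by
    rw [hz.pairing_swap hy, hy.pairing_coboundaryAddDisp, hyx, hyy, mul_zero, mul_neg_one, add_zero,
      neg_neg]
  refine ⟨g, g', ?_⟩
  rw [ha, hb, coboundaryAddDisp_apply, neg_smul, sub_neg_eq_add, add_comm]

end Dimer

/-! ### Crossings of matchings and zigzag paths -/

namespace Dimer

variable {E : Type*} [Fintype E] (D : Dimer E)

noncomputable instance : Fintype D.ZigzagPath := Fintype.ofFinite _

/-- The number of times that the zigzag path runs along the edge, in either direction. -/
noncomputable def crossing (Z : D.ZigzagPath) (e : E) : ℤ :=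
  (if D.zigOut e = Z then 1 else 0) + if D.zigIn e = Z then 1 else 0

/-- A primitive of the cochain of crossings with a zigzag path: following the boundary of a face
with corners at the white nodes, one crosses the path into the corner that it cuts off. -/
noncomputable def crossingPrimitive (Z : D.ZigzagPath) (e : E) : ℝ :=
  if D.zigOut e = Z then -1 else 0

theorem sum_zigIn {A : Type*} [AddCommMonoid A] (Z : D.ZigzagPath) (f : E → A) :
    ∑ e with D.zigIn e = Z, f e = ∑ e with D.zigOut e = Z, f (D.rotW e) := by
  have reindex := Equiv.sum_comp D.rotW fun e => if D.zigIn e = Z then f e else 0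
  simp only [zigIn_rotW] at reindex
  rw [Finset.sum_filter, Finset.sum_filter, reindex]

theorem card_zigIn (Z : D.ZigzagPath) :
    Finset.card {e | D.zigIn e = Z} = Finset.card {e | D.zigOut e = Z} := by
  rw [Finset.card_eq_sum_ones, Finset.card_eq_sum_ones, sum_zigIn]

theorem winding_eq_sum_sub_sum (Z : D.ZigzagPath) :
    D.winding Z = ∑ e with D.zigIn e = Z, D.disp e - ∑ e with D.zigOut e = Z, D.disp e := by
  rw [winding, Finset.sum_sub_distrib, sum_zigIn]

theorem sum_winding : ∑ Z, D.winding Z = 0 := by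
  simp only [winding]
  rw [Finset.sum_fiberwise, Finset.sum_sub_distrib, Equiv.sum_comp D.rotW, sub_self]

theorem isPrimitive_crossing (Z : D.ZigzagPath) :
    D.IsPrimitive (D.crossingPrimitive Z) fun e => D.crossing Z e := by
  intro e
  have zigIn_eq : D.zigIn (D.rotB⁻¹ e) = D.zigOut (facePerm D.rotW D.rotB e) := by
    rw [facePerm, Equiv.Perm.mul_apply, zigOut_rotW_inv]
  simp only [crossingPrimitive, crossing, zigOut_rotB_inv, zigIn_eq]
  split_ifs <;> norm_num

theorem pairing_crossingPrimitive (Z : D.ZigzagPath) (β : E → ℝ) :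
    D.pairing (D.crossingPrimitive Z) β = ∑ e with D.zigOut e = Z, (β (D.rotW e) - β e) := by
  rw [Finset.sum_sub_distrib, ← sum_zigIn, Finset.sum_filter, Finset.sum_filter,
    ← Finset.sum_sub_distrib, pairing_apply]
  refine Finset.sum_congr rfl fun e _ => ?_
  rw [jump, crossingPrimitive, crossingPrimitive, zigOut_rotW_inv]
  by_cases hout : D.zigOut e = Z <;> by_cases hin : D.zigIn e = Z <;> simp [hout, hin]

theorem pairing_crossingPrimitive_dispX (Z : D.ZigzagPath) :
    D.pairing (D.crossingPrimitive Z) D.dispX = (D.winding Z).1 := by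
  simp [pairing_crossingPrimitive, winding, Prod.fst_sum, dispX]

theorem pairing_crossingPrimitive_dispY (Z : D.ZigzagPath) :
    D.pairing (D.crossingPrimitive Z) D.dispY = (D.winding Z).2 := by
  simp [pairing_crossingPrimitive, winding, Prod.snd_sum, dispY]

theorem exists_crossing_eq_wedge_add_coboundary (Z : D.ZigzagPath) :
    ∃ (g : D.White → ℝ) (g' : D.Black → ℝ), ∀ e, (D.crossing Z e : ℝ) =
      (wedge (D.disp e) (D.winding Z) : ℤ) + D.coboundary g g' e := by
  obtain ⟨g, g', h⟩ := (D.isPrimitive_crossing Z).exists_eq_add_coboundary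
  refine ⟨g, g', fun e => ?_⟩
  rw [congrFun h e, pairing_crossingPrimitive_dispX, pairing_crossingPrimitive_dispY]
  simp [wedge, dispX, dispY, mul_comm]

theorem winding_eq_zero_of_crossing_eq_coboundary {Z : D.ZigzagPath} {g : D.White → ℝ}
    {g' : D.Black → ℝ} (h : ∀ e, (D.crossing Z e : ℝ) = D.coboundary g g' e) :
    D.winding Z = 0 := by
  obtain ⟨x, y, ⟨hx, -⟩, hy, -⟩ := D.exists_isPrimitive_disp
  have pairing_eq_zero {z α : E → ℝ} (hz : D.IsPrimitive z α) :
      D.pairing (D.crossingPrimitive Z) α = 0 := by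
    rw [(D.isPrimitive_crossing Z).pairing_swap hz, funext h, hz.pairing_coboundary, neg_zero]
  refine Prod.ext ?_ ?_
  · exact_mod_cast D.pairing_crossingPrimitive_dispX Z ▸ pairing_eq_zero hx
  · exact_mod_cast D.pairing_crossingPrimitive_dispY Z ▸ pairing_eq_zero hy

/-- The displacement of a set of edges. -/
def totalDisp (M : Finset E) : ℤ × ℤ := ∑ e ∈ M, D.disp e

variable {D}

namespace IsPerfectMatching

variable {M M' : Finset E}

theorem eq_of_white (hM : D.IsPerfectMatching M) {e e' : E} (he : e ∈ M) (he' : e' ∈ M)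
    (h : D.white e = D.white e') : e = e' :=
  (hM.1 (D.white e)).unique ⟨he, rfl⟩ ⟨he', h.symm⟩

theorem eq_of_black (hM : D.IsPerfectMatching M) {e e' : E} (he : e ∈ M) (he' : e' ∈ M)
    (h : D.black e = D.black e') : e = e' :=
  (hM.2 (D.black e)).unique ⟨he, rfl⟩ ⟨he', h.symm⟩

theorem sum_white {A : Type*} [AddCommMonoid A] (hM : D.IsPerfectMatching M) (g : D.White → A) :
    ∑ e ∈ M, g (D.white e) = ∑ v, g v := by
  refine Finset.sum_nbij D.white (by simp) (fun e he e' he' => hM.eq_of_white he he')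
    (fun v _ => ?_) fun _ _ => rfl
  obtain ⟨e, he, -⟩ := hM.1 v
  exact ⟨e, he⟩

theorem sum_black {A : Type*} [AddCommMonoid A] (hM : D.IsPerfectMatching M) (g : D.Black → A) :
    ∑ e ∈ M, g (D.black e) = ∑ v, g v := by
  refine Finset.sum_nbij D.black (by simp) (fun e he e' he' => hM.eq_of_black he he')
    (fun v _ => ?_) fun _ _ => rfl
  obtain ⟨e, he, -⟩ := hM.2 v
  exact ⟨e, he⟩

theorem card_white_eq_card_black (hM : D.IsPerfectMatching M) :
    Nat.card D.White = Nat.card D.Black := by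
  have card_eq := (hM.sum_white fun _ => (1 : ℕ)).symm.trans (hM.sum_black fun _ => 1)
  simpa only [Finset.sum_const, Finset.card_univ, smul_eq_mul, mul_one,
    ← Nat.card_eq_fintype_card] using card_eq

theorem sum_coboundary {A : Type*} [AddCommGroup A] (hM : D.IsPerfectMatching M)
    (g : D.White → A) (g' : D.Black → A) :
    ∑ e ∈ M, D.coboundary g g' e = ∑ b, g' b - ∑ v, g v := by
  simp only [coboundary, Finset.sum_sub_distrib, hM.sum_white, hM.sum_black]

theorem sum_crossing_sub_sum_crossing (hM : D.IsPerfectMatching M) (hM' : D.IsPerfectMatching M')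
    (Z : D.ZigzagPath) :
    ∑ e ∈ M, D.crossing Z e - ∑ e ∈ M', D.crossing Z e =
      wedge (D.totalDisp M - D.totalDisp M') (D.winding Z) := by
  obtain ⟨g, g', hg⟩ := D.exists_crossing_eq_wedge_add_coboundary Z
  have sum_crossing {N : Finset E} (hN : D.IsPerfectMatching N) :
      ((∑ e ∈ N, D.crossing Z e : ℤ) : ℝ) =
        (wedge (D.totalDisp N) (D.winding Z) : ℤ) + (∑ b, g' b - ∑ v, g v) := by
    rw [totalDisp, wedge_sum_left, ← hN.sum_coboundary]
    push_cast
    rw [← Finset.sum_add_distrib]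
    exact Finset.sum_congr rfl fun e _ => hg e
  rify
  have h := sum_crossing hM
  have h' := sum_crossing hM'
  simp only [wedge, Prod.fst_sub, Prod.snd_sub] at h h' ⊢
  push_cast at h h' ⊢
  linear_combination h - h'

end IsPerfectMatching

namespace ProperlyOrdered

variable {Z : D.ZigzagPath}

theorem crossing_of_zigOut (hD : D.ProperlyOrdered) {e : E} (h : D.zigOut e = Z) :
    D.crossing Z e = 1 := by
  rw [crossing, if_pos h, if_neg fun h' => hD.zigIn_ne_zigOut e (h'.trans h.symm), add_zero]

theorem crossing_of_zigIn (hD : D.ProperlyOrdered) {e : E} (h : D.zigIn e = Z) :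
    D.crossing Z e = 1 := by
  rw [crossing, if_pos h, if_neg fun h' => hD.zigIn_ne_zigOut e (h.trans h'.symm), zero_add]

/-! ### Windings are primitive vectors -/

/-- Along the path, the coboundary relation alternately adds and subtracts `a`, so that `g` is
constant on its white nodes. -/
theorem eq_of_crossing_smul_eq_coboundary (hD : D.ProperlyOrdered) {A : Type*} [AddCommGroup A]
    {a : A} {g : D.White → A} {g' : D.Black → A}
    (h : ∀ e, D.crossing Z e • a = D.coboundary g g' e) {e e' : E} (he : D.zigOut e = Z)
    (he' : D.zigOut e' = Z) : g (D.white e') = g (D.white e) := by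
  have step {e : E} (he : D.zigOut e = Z) :
      D.zigOut (D.zigzagPerm e) = Z ∧ g (D.white (D.zigzagPerm e)) = g (D.white e) := by
    have hnext : D.zigOut (D.zigzagPerm e) = Z := by
      rw [zigzagPerm, Equiv.Perm.mul_apply, zigOut_rotB_inv, zigIn_rotW, he]
    have hin := h (D.rotW e)
    have hout := h (D.zigzagPerm e)
    rw [hD.crossing_of_zigIn (by rw [zigIn_rotW, he]), coboundary, white_rotW] at hin
    rw [hD.crossing_of_zigOut hnext, hin, coboundary, zigzagPerm, Equiv.Perm.mul_apply,
      black_rotB_inv, sub_right_inj] at hout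
    exact ⟨hnext, hout.symm⟩
  obtain ⟨n, rfl⟩ := (D.zigOut_eq_zigOut.1 (he.trans he'.symm)).exists_nat_pow_eq
  clear he'
  induction n generalizing e with
  | zero => rfl
  | succ n ih =>
    rw [pow_succ, Equiv.Perm.mul_apply, ih (step he).1, (step he).2]

/-- Since the path is simple, a coboundary with values `0` and `a ≠ 0` lifts to one with values `0`
and `1` in the real numbers. -/
theorem eq_zero_of_crossing_smul_eq_coboundary (hD : D.ProperlyOrdered) {A : Type*}
    [AddCommGroup A] {a : A} {g : D.White → A} {g' : D.Black → A}
    (h : ∀ e, D.crossing Z e • a = D.coboundary g g' e) : a = 0 := by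
  classical
  by_contra ha
  obtain ⟨e₀, he₀⟩ := D.zigOut_surjective Z
  have white_eq {e : E} (he : D.zigOut e = Z ∨ D.zigIn e = Z) :
      g (D.white e) = g (D.white e₀) := by
    rcases he with he | he
    · exact hD.eq_of_crossing_smul_eq_coboundary h he₀ he
    · rw [← D.white_rotW_inv e]
      exact hD.eq_of_crossing_smul_eq_coboundary h he₀ he
  refine hD.winding_ne_zero Z (D.winding_eq_zero_of_crossing_eq_coboundary
    (g := fun v => if g v = g (D.white e₀) then 0 else 1)
    (g' := fun b => if g' b = g (D.white e₀) then 0 else 1) fun e => ?_)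
  have he := h e
  by_cases hZ : D.zigOut e = Z ∨ D.zigIn e = Z
  · have crossing_eq : D.crossing Z e = 1 := hZ.elim hD.crossing_of_zigOut hD.crossing_of_zigIn
    rw [crossing_eq, one_smul, coboundary, eq_sub_iff_add_eq, white_eq hZ] at he
    have : g' (D.black e) ≠ g (D.white e₀) := fun h' => ha (by simpa [h'] using he)
    simp [crossing_eq, coboundary, white_eq hZ, this]
  · have crossing_eq : D.crossing Z e = 0 := by simp_all [crossing]
    rw [crossing_eq, zero_smul, coboundary, eq_comm, sub_eq_zero] at he
    simp [crossing_eq, coboundary, he]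

theorem isUnit_of_winding_eq_smul (hD : D.ProperlyOrdered) {k : ℤ} {v : ℤ × ℤ}
    (h : D.winding Z = k • v) : IsUnit k := by
  obtain ⟨g, g', hg⟩ := D.exists_crossing_eq_wedge_add_coboundary Z
  let mod : ℝ →+ ℝ ⧸ AddSubgroup.zmultiples (k : ℝ) := QuotientAddGroup.mk' _
  have mod_one : mod 1 = 0 := by
    refine hD.eq_zero_of_crossing_smul_eq_coboundary (Z := Z) (g := mod ∘ g) (g' := mod ∘ g')
      fun e => ?_
    have wedge_eq : mod (wedge (D.disp e) (D.winding Z) : ℤ) = 0 :=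
      (QuotientAddGroup.eq_zero_iff _).2 (AddSubgroup.mem_zmultiples_iff.2
        ⟨wedge (D.disp e) v, by rw [h, wedge_smul_right, zsmul_eq_mul]; push_cast; ring⟩)
    rw [← map_zsmul, zsmul_one, hg, map_add, wedge_eq, zero_add]
    exact map_sub mod _ _
  obtain ⟨m, hm⟩ := AddSubgroup.mem_zmultiples_iff.1
    ((QuotientAddGroup.eq_zero_iff (1 : ℝ)).1 mod_one)
  rw [zsmul_eq_mul] at hm
  exact IsUnit.of_mul_eq_one_right m (by exact_mod_cast hm)

theorem isCoprime_winding (hD : D.ProperlyOrdered) (Z : D.ZigzagPath) :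
    IsCoprime (D.winding Z).1 (D.winding Z).2 := by
  refine isCoprime_of_dvd _ _ (fun h => hD.winding_ne_zero Z (Prod.ext h.1 h.2)) ?_
  rintro k hk - ⟨a, ha⟩ ⟨b, hb⟩
  exact hk (hD.isUnit_of_winding_eq_smul (v := (a, b)) (Prod.ext ha hb))

/-! ### Half planes that contain the displacements of all perfect matchings -/

variable {M M₀ : Finset E} {r : ℝ × ℝ}

theorem sum_crossing_le (hD : D.ProperlyOrdered) (hM : D.IsPerfectMatching M)
    (Z : D.ZigzagPath) : ∑ e ∈ M, D.crossing Z e ≤ Finset.card {e | D.zigOut e = Z} := by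
  classical
  have crossing_eq (e : E) : D.crossing Z e = if D.zigOut e = Z ∨ D.zigIn e = Z then 1 else 0 := by
    split_ifs with h
    · exact h.elim hD.crossing_of_zigOut hD.crossing_of_zigIn
    · simp_all [crossing]
  simp only [crossing_eq, Finset.sum_boole, Nat.cast_le]
  let start (e : E) : E := if D.zigOut e = Z then e else D.rotW⁻¹ e
  have white_start (e : E) : D.white (start e) = D.white e := by
    simp only [start]
    split_ifs
    · rfl
    · exact D.white_rotW_inv e
  refine Finset.card_le_card_of_injOn start (fun e he => ?_) fun e he e' he' h => ?_
  · simp only [Finset.coe_filter, Set.mem_ofPred_eq, Finset.mem_univ, true_and, start] at he ⊢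
    split_ifs with hout
    · exact hout
    · exact he.2.resolve_left hout
  · exact hM.eq_of_white (Finset.mem_filter.1 he).1 (Finset.mem_filter.1 he').1
      (by rw [← white_start e, h, white_start])

theorem wedge_nonneg_of_subset (hD : D.ProperlyOrdered) (hM : D.IsPerfectMatching M)
    (hM₀ : D.IsPerfectMatching M₀) {S : Finset E} (hS : ∀ e ∈ S, e ∈ M₀ ∧ D.crossing Z e = 1)
    (hcard : Finset.card {e | D.zigOut e = Z} ≤ S.card) :
    0 ≤ wedge (D.winding Z) (D.totalDisp M - D.totalDisp M₀) := by
  have crossing_nonneg (e : E) : 0 ≤ D.crossing Z e := by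
    rw [crossing]; split_ifs <;> norm_num
  have card_le : (S.card : ℤ) ≤ ∑ e ∈ M₀, D.crossing Z e := calc
    (S.card : ℤ) = ∑ e ∈ S, D.crossing Z e := by
      rw [Finset.sum_congr rfl fun e he => (hS e he).2, Finset.card_eq_sum_ones, Nat.cast_sum,
        Nat.cast_one]
    _ ≤ ∑ e ∈ M₀, D.crossing Z e :=
      Finset.sum_le_sum_of_subset_of_nonneg (fun e he => (hS e he).1)
        fun e _ _ => crossing_nonneg e
  have crossing_sub := hM.sum_crossing_sub_sum_crossing hM₀ Z
  have crossing_le := hD.sum_crossing_le hM Z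
  rw [wedge_swap]
  linarith

theorem zigOut_mem_rayMatching (hD : D.ProperlyOrdered) (hr : D.IsGenericRay r) {e : E}
    (h : D.IsFirstCcw r Set.univ (D.zigOut e)) : e ∈ D.rayMatching r :=
  (hD.mem_rayMatching hr).2 <|
    ((hD.ccw_or_ccw hr (hD.not_sameDir e)).resolve_left (h _ trivial)).rotate.rotate

theorem zigIn_mem_rayMatching (hD : D.ProperlyOrdered) (hr : D.IsGenericRay r) {e : E}
    (h : D.IsFirstCw r Set.univ (D.zigIn e)) : e ∈ D.rayMatching r :=
  (hD.mem_rayMatching hr).2 <|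
    ((hD.ccw_or_ccw hr (hD.not_sameDir e)).resolve_left
      fun h' => h _ trivial h'.rotate).rotate.rotate

theorem wedge_nonneg_of_isFirstCcw (hD : D.ProperlyOrdered) (hr : D.IsGenericRay r)
    (hZ : D.IsFirstCcw r Set.univ Z) (hM : D.IsPerfectMatching M) :
    0 ≤ wedge (D.winding Z) (D.totalDisp M - D.totalDisp (D.rayMatching r)) :=
  hD.wedge_nonneg_of_subset hM (hD.isPerfectMatching_rayMatching hr)
    (S := {e | D.zigOut e = Z}) (fun e he => by
      rw [Finset.mem_filter_univ] at he
      exact ⟨hD.zigOut_mem_rayMatching hr (by rwa [he]), hD.crossing_of_zigOut he⟩) le_rfl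

theorem wedge_nonneg_of_isFirstCw (hD : D.ProperlyOrdered) (hr : D.IsGenericRay r)
    (hZ : D.IsFirstCw r Set.univ Z) (hM : D.IsPerfectMatching M) :
    0 ≤ wedge (D.winding Z) (D.totalDisp M - D.totalDisp (D.rayMatching r)) :=
  hD.wedge_nonneg_of_subset hM (hD.isPerfectMatching_rayMatching hr)
    (S := {e | D.zigIn e = Z}) (fun e he => by
      rw [Finset.mem_filter_univ] at he
      exact ⟨hD.zigIn_mem_rayMatching hr (by rwa [he]), hD.crossing_of_zigIn he⟩)
    (D.card_zigIn Z).ge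

end ProperlyOrdered

end Dimer

/-! ### Matchings of different rays -/

open Classical in
theorem ite_ccw_sub_ite_ccw {R A : Type*} [CommRing R] [LinearOrder R] [IsStrictOrderedRing R]
    [AddCommGroup A] {a b r s : R × R} (ha : a ≠ 0) (hb : b ≠ 0) (hr : r ≠ 0) (hs : s ≠ 0)
    (hab : ¬ SameDir a b) (hra : ¬ SameDir r a) (hrb : ¬ SameDir r b) (hsa : ¬ SameDir s a)
    (hsb : ¬ SameDir s b) (hrs : ¬ SameDir r s) (d : A) :
    ((if Ccw a s b then d else 0) - if Ccw a r b then d else 0) =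
      (if Ccw r a s then d else 0) - if Ccw r b s then d else 0 := by
  have har := ccw_or_ccw_of_not_sameDir ha hr hb (hra ·.symm) hab hrb
  have has := ccw_or_ccw_of_not_sameDir ha hs hb (hsa ·.symm) hab hsb
  have hars := ccw_or_ccw_of_not_sameDir ha hr hs (hra ·.symm) (hsa ·.symm) hrs
  rcases har with har | har <;> rcases has with has | has <;> rcases hars with hars | hars <;>
    grind [Ccw.trans_right, Ccw.not_swap, Ccw.rotate]

namespace Dimer

variable {E : Type*} [Fintype E] {D : Dimer E}

theorem totalDisp_eq_sum_ite [DecidableEq E] (M : Finset E) :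
    D.totalDisp M = ∑ e, if e ∈ M then D.disp e else 0 := by
  rw [totalDisp, Finset.sum_ite_mem, Finset.univ_inter]

namespace ProperlyOrdered

variable {r₁ r₂ : ℝ × ℝ} {w : ℤ × ℤ}

open Classical in
theorem totalDisp_sub_totalDisp (hD : D.ProperlyOrdered) (h₁ : D.IsGenericRay r₁)
    (h₂ : D.IsGenericRay r₂) (hne : ¬ SameDir r₁ r₂) :
    D.totalDisp (D.rayMatching r₂) - D.totalDisp (D.rayMatching r₁) =
      ∑ Z with Ccw r₁ (D.windingR Z) r₂, D.winding Z := by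
  have fiberwise (P : E → D.ZigzagPath) :
      ∑ Z with Ccw r₁ (D.windingR Z) r₂, ∑ e with P e = Z, D.disp e =
        ∑ e, if Ccw r₁ (D.windingR (P e)) r₂ then D.disp e else 0 := by
    rw [← Finset.sum_filter, Finset.sum_fiberwise_eq_sum_filter]
    simp only [Finset.mem_filter_univ]
  simp only [winding_eq_sum_sub_sum, Finset.sum_sub_distrib, fiberwise, totalDisp_eq_sum_ite,
    hD.mem_rayMatching h₁, hD.mem_rayMatching h₂]
  rw [← Finset.sum_sub_distrib, ← Finset.sum_sub_distrib]
  exact Finset.sum_congr rfl fun e _ => ite_ccw_sub_ite_ccw (hD.windingR_ne_zero _)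
    (hD.windingR_ne_zero _) h₁.1 h₂.1 (hD.not_sameDir e) (h₁.2 _) (h₁.2 _) (h₂.2 _) (h₂.2 _) hne _

theorem totalDisp_sub_totalDisp_eq_card_smul (hD : D.ProperlyOrdered) (h₁ : D.IsGenericRay r₁)
    (h₂ : D.IsGenericRay r₂) (hw : ∃ Z, D.winding Z = w)
    (h : ∀ Z, Ccw r₁ (D.windingR Z) r₂ ↔ D.winding Z = w) :
    D.totalDisp (D.rayMatching r₂) - D.totalDisp (D.rayMatching r₁) =
      Nat.card {Z : D.ZigzagPath // D.winding Z = w} • w := by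
  obtain ⟨Z, hZ⟩ := hw
  classical
  rw [hD.totalDisp_sub_totalDisp h₁ h₂ ((h Z).2 hZ).not_sameDir]
  simp only [h]
  rw [Finset.sum_congr rfl fun Z hZ => (Finset.mem_filter.1 hZ).2, Finset.sum_const,
    Nat.card_eq_fintype_card, Fintype.card_subtype]

end ProperlyOrdered

end Dimer

/-! ### Windings around the origin -/

theorem CyclicallyOrdered.card_le_two_mul {E R : Type*} [Fintype E] [CommRing R] [LinearOrder R]
    {ρ : Equiv.Perm E} {V : E → R × R} (h : CyclicallyOrdered ρ V)
    (hV : ∀ e e', wedge (V e) (V e') = 0) :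
    Fintype.card E ≤ 2 * Nat.card (Quotient (Equiv.Perm.SameCycle.setoid ρ)) := by
  classical
  have : Fintype (Quotient (Equiv.Perm.SameCycle.setoid ρ)) := Fintype.ofFinite _
  rw [Nat.card_eq_fintype_card]
  refine Finset.card_le_mul_card_image_of_maps_to (f := Quotient.mk _)
    (fun _ _ => Finset.mem_univ _) 2 fun v _ => ?_
  obtain ⟨e₀, rfl⟩ := Quotient.mk_surjective v
  refine (Finset.card_le_card fun e he => ?_).trans (Finset.card_le_two (a := e₀) (b := ρ e₀))
  have hs : ρ.SameCycle e₀ e := (Quotient.eq.1 (Finset.mem_filter.1 he).2).symm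
  rw [Finset.mem_insert, Finset.mem_singleton]
  by_contra! hne
  simpa [Ccw, hV] using h.ccw e₀ e hs hne.1 hne.2

namespace Dimer

variable {E : Type*} [Fintype E] {D : Dimer E} {r : ℝ × ℝ}

variable (D) in
theorem exists_isFirstCcw (r : ℝ × ℝ) : ∃ Z, D.IsFirstCcw r Set.univ Z := by
  obtain ⟨e⟩ := D.nonempty_edge
  obtain ⟨Z, -, hZ⟩ := exists_first_ccw r D.windingR ⟨D.zigOut e, Set.mem_univ _⟩
  exact ⟨Z, hZ⟩

variable (D) in
theorem exists_isFirstCw (r : ℝ × ℝ) : ∃ Z, D.IsFirstCw r Set.univ Z := by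
  obtain ⟨e⟩ := D.nonempty_edge
  obtain ⟨Z, -, hZ⟩ := exists_last_ccw r D.windingR ⟨D.zigOut e, Set.mem_univ _⟩
  exact ⟨Z, fun Y hY h => hZ Y hY h.rotate.rotate⟩

namespace ProperlyOrdered

variable {Y Z Z₁ Z₂ : D.ZigzagPath}

theorem sameDir_windingR (hD : D.ProperlyOrdered) :
    SameDir (D.windingR Y) (D.windingR Z) ↔ D.winding Y = D.winding Z := by
  rw [windingR, windingR, sameDir_toReal]
  refine ⟨eq_of_sameDir (hD.isCoprime_winding Y) (hD.isCoprime_winding Z), fun h => ?_⟩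
  rw [h]
  exact ⟨wedge_self _, normSq_pos (hD.winding_ne_zero Z)⟩

/-- If all windings were parallel, no node could have more than two edges, which leaves no face in
the Euler characteristic. -/
theorem exists_wedge_ne_zero (hD : D.ProperlyOrdered) {u : ℤ × ℤ} (hu : u ≠ 0) :
    ∃ Z, wedge u (D.winding Z) ≠ 0 := by
  by_contra! h
  have parallel (Y Z : D.ZigzagPath) : wedge (D.windingR Y) (D.windingR Z) = 0 := by
    have key := normSq_mul_wedge u (D.winding Y) (D.winding Z)
    rw [h, h, mul_zero, mul_zero, sub_zero] at key
    rw [windingR, windingR, wedge_toReal, (mul_eq_zero.1 key).resolve_left (normSq_pos hu).ne',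
      Int.cast_zero]
  have white_le := hD.cyclicallyOrdered_white.card_le_two_mul fun _ _ => parallel _ _
  have black_le := hD.cyclicallyOrdered_black.card_le_two_mul fun _ _ => parallel _ _
  have face_pos : 0 < Nat.card D.Face :=
    Nat.card_pos_iff.2 ⟨D.nonempty_edge.map D.face, inferInstance⟩
  have euler := D.euler
  change _ + _ + Nat.card D.Face = _ at euler
  omega

theorem wedge_pos_of_isFirst (hD : D.ProperlyOrdered) (hr : D.IsGenericRay r)
    (h₁ : D.IsFirstCw r Set.univ Z₁) (h₂ : D.IsFirstCcw r Set.univ Z₂) :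
    0 < wedge (D.windingR Z₁) (D.windingR Z₂) := by
  by_contra! hle
  have hle' : 0 ≤ wedge (D.windingR Z₂) (D.windingR Z₁) := by rw [wedge_swap]; linarith
  have wedge_nonneg (Z : D.ZigzagPath) : 0 ≤ wedge (D.windingR Z₂) (D.windingR Z) := by
    by_cases hZ₂ : SameDir (D.windingR Z₂) (D.windingR Z)
    · exact hZ₂.1.ge
    by_cases hZ₁ : SameDir (D.windingR Z₁) (D.windingR Z)
    · rwa [windingR, windingR, ← hD.sameDir_windingR.1 hZ₁]
    have after_Z₂ := (hD.ccw_or_ccw hr hZ₂).resolve_right (h₂ Z trivial)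
    have before_Z₁ := (hD.ccw_or_ccw hr hZ₁).resolve_left fun h => h₁ Z trivial h.rotate
    exact ((after_Z₂.trans_right before_Z₁).wedge_pos hle').1.le
  have sum_wedge : ∑ Z, wedge (D.winding Z₂) (D.winding Z) = 0 := by
    rw [← wedge_sum_right, sum_winding]; simp [wedge]
  simp only [windingR, wedge_toReal, Int.cast_nonneg_iff] at wedge_nonneg
  obtain ⟨Z, hZ⟩ := hD.exists_wedge_ne_zero (hD.winding_ne_zero Z₂)
  exact hZ ((Finset.sum_eq_zero_iff_of_nonneg fun Z _ => wedge_nonneg Z).1 sum_wedge Z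
    (Finset.mem_univ _))

end ProperlyOrdered

end Dimer

/-! ### Exchanging the two halves of a zigzag path -/

theorem existsUnique_exchange {E N : Type*} [DecidableEq E] {ν : E → N} {π : Equiv.Perm E}
    (hν : ∀ e, ν (π e) = ν e) {M A A' : Finset E} (hA : A ⊆ M) (hA' : ∀ e, π e ∈ A' ↔ e ∈ A)
    {n : N} (h : ∃! e, e ∈ M ∧ ν e = n) : ∃! e, e ∈ M \ A ∪ A' ∧ ν e = n := by
  obtain ⟨m, ⟨hm, hmn⟩, huniq⟩ := h
  have eq_of_mem {e : E} (he : e ∈ A') (hen : ν e = n) : m ∈ A ∧ e = π m := by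
    have hmem : π⁻¹ e ∈ A := by rwa [← hA', perm_apply_inv]
    have hm : π⁻¹ e = m := huniq _ ⟨hA hmem, by rw [← hν, perm_apply_inv, hen]⟩
    exact ⟨hm ▸ hmem, by rw [← hm, perm_apply_inv]⟩
  simp only [Finset.mem_union, Finset.mem_sdiff]
  by_cases hmA : m ∈ A
  · refine ⟨π m, ⟨Or.inr ((hA' m).2 hmA), by rw [hν, hmn]⟩, ?_⟩
    rintro e ⟨⟨he, heA⟩ | he, hen⟩
    · exact absurd (huniq e ⟨he, hen⟩ ▸ hmA) heA
    · exact (eq_of_mem he hen).2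
  · refine ⟨m, ⟨Or.inl ⟨hm, hmA⟩, hmn⟩, ?_⟩
    rintro e ⟨⟨he, -⟩ | he, hen⟩
    · exact huniq e ⟨he, hen⟩
    · exact absurd (eq_of_mem he hen).1 hmA

namespace Dimer

variable {E : Type*} [Fintype E] {D : Dimer E}

namespace IsPerfectMatching

variable {M M' : Finset E}

theorem exists_exchange (hM : D.IsPerfectMatching M) {πW πB : Equiv.Perm E}
    (hW : ∀ e, D.white (πW e) = D.white e) (hB : ∀ e, D.black (πB e) = D.black e)
    {A A' : Finset E} (hA : A ⊆ M) (hAW : ∀ e, πW e ∈ A' ↔ e ∈ A) (hAB : ∀ e, πB e ∈ A' ↔ e ∈ A)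
    (hdisj : Disjoint A A') :
    ∃ M', D.IsPerfectMatching M' ∧
      D.totalDisp M' = D.totalDisp M - D.totalDisp A + D.totalDisp A' := by
  classical
  have disjoint_sdiff : Disjoint (M \ A) A' := by
    refine Finset.disjoint_left.2 fun e he he' => Finset.disjoint_left.1 hdisj ?_ he'
    have hmem : πW⁻¹ e ∈ A := by rwa [← hAW, perm_apply_inv]
    rwa [hM.eq_of_white (hA hmem) (Finset.mem_sdiff.1 he).1 (by rw [← hW, perm_apply_inv])] at hmem
  refine ⟨M \ A ∪ A', ⟨fun v => existsUnique_exchange hW hA hAW (hM.1 v),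
    fun b => existsUnique_exchange hB hA hAB (hM.2 b)⟩, ?_⟩
  rw [totalDisp, Finset.sum_union disjoint_sdiff, Finset.sum_sdiff_eq_sub hA]
  rfl

theorem exists_mem_sdiff_white (hM : D.IsPerfectMatching M) (hM' : D.IsPerfectMatching M')
    [DecidableEq E] {e : E} (he : e ∈ M \ M') : ∃ e' ∈ M' \ M, D.white e' = D.white e := by
  rw [Finset.mem_sdiff] at he
  obtain ⟨e', ⟨he', hwhite⟩, -⟩ := hM'.1 (D.white e)
  refine ⟨e', Finset.mem_sdiff.2 ⟨he', fun hmem => he.2 ?_⟩, hwhite⟩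
  rwa [hM.eq_of_white he.1 hmem hwhite.symm]

theorem exists_mem_sdiff_black (hM : D.IsPerfectMatching M) (hM' : D.IsPerfectMatching M')
    [DecidableEq E] {e : E} (he : e ∈ M \ M') : ∃ e' ∈ M' \ M, D.black e' = D.black e := by
  rw [Finset.mem_sdiff] at he
  obtain ⟨e', ⟨he', hblack⟩, -⟩ := hM'.2 (D.black e)
  refine ⟨e', Finset.mem_sdiff.2 ⟨he', fun hmem => he.2 ?_⟩, hblack⟩
  rwa [hM.eq_of_black he.1 hmem hblack.symm]

theorem sdiff_nonempty (hM : D.IsPerfectMatching M) (hM' : D.IsPerfectMatching M')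
    [DecidableEq E] (hne : M ≠ M') : (M \ M').Nonempty := by
  contrapose! hne
  refine (Finset.sdiff_eq_empty_iff_subset.1 hne).antisymm fun e he => ?_
  by_contra heM
  obtain ⟨e', he', -⟩ := hM'.exists_mem_sdiff_white hM (Finset.mem_sdiff.2 ⟨he, heM⟩)
  exact Finset.notMem_empty e' (hne ▸ he')

end IsPerfectMatching

namespace ProperlyOrdered

variable {M : Finset E} {Z : D.ZigzagPath}

theorem disjoint_zigOut_zigIn (hD : D.ProperlyOrdered) (Z : D.ZigzagPath) :
    Disjoint ({e | D.zigOut e = Z} : Finset E) ({e | D.zigIn e = Z} : Finset E) :=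
  Finset.disjoint_filter.2 fun e _ hout hin => hD.zigIn_ne_zigOut e (hin.trans hout.symm)

theorem exists_totalDisp_eq_add (hD : D.ProperlyOrdered) (hM : D.IsPerfectMatching M)
    (h : ∀ e, D.zigOut e = Z → e ∈ M) :
    ∃ M', D.IsPerfectMatching M' ∧ D.totalDisp M' = D.totalDisp M + D.winding Z := by
  obtain ⟨M', hM', hdisp⟩ := hM.exists_exchange (A := {e | D.zigOut e = Z})
    (A' := {e | D.zigIn e = Z}) D.white_rotW D.black_rotB (fun e he => h e (by simpa using he))
    (by simp [zigIn_rotW]) (by simp [zigIn_rotB]) (hD.disjoint_zigOut_zigIn Z)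
  exact ⟨M', hM', by rw [hdisp, winding_eq_sum_sub_sum, totalDisp, totalDisp, totalDisp]; abel⟩

theorem exists_totalDisp_eq_sub (hD : D.ProperlyOrdered) (hM : D.IsPerfectMatching M)
    (h : ∀ e, D.zigIn e = Z → e ∈ M) :
    ∃ M', D.IsPerfectMatching M' ∧ D.totalDisp M' = D.totalDisp M - D.winding Z := by
  obtain ⟨M', hM', hdisp⟩ := hM.exists_exchange (A := {e | D.zigIn e = Z})
    (A' := {e | D.zigOut e = Z}) D.white_rotW_inv D.black_rotB_inv
    (fun e he => h e (by simpa using he))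
    (by simp only [Finset.mem_filter_univ, zigOut_rotW_inv, implies_true])
    (by simp only [Finset.mem_filter_univ, zigOut_rotB_inv, implies_true])
    (hD.disjoint_zigOut_zigIn Z).symm
  exact ⟨M', hM', by rw [hdisp, winding_eq_sum_sub_sum, totalDisp, totalDisp, totalDisp]; abel⟩

end ProperlyOrdered

end Dimer

/-! ### The matching of a ray is determined by its displacement -/

theorem inv_apply_mem_of_card_eq {E : Type*} {π : Equiv.Perm E} {A B : Finset E}
    (hπ : ∀ e ∈ A, π e ∈ B) (hcard : A.card = B.card) {e : E} (he : e ∈ B) : π⁻¹ e ∈ A := by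
  obtain ⟨e', he', rfl⟩ := Finset.surjOn_of_injOn_of_card_le π hπ π.injective.injOn hcard.ge he
  rwa [perm_inv_apply]

namespace Dimer

variable {E : Type*} [Fintype E] {D : Dimer E} {r : ℝ × ℝ} {e m : E} {M : Finset E}
  {Z : D.ZigzagPath}

namespace ProperlyOrdered

theorem ccw_zigIn_zigOut (hD : D.ProperlyOrdered) (hr : D.IsGenericRay r)
    (he : e ∉ D.rayMatching r) : Ccw r (D.windingR (D.zigIn e)) (D.windingR (D.zigOut e)) :=
  (hD.ccw_or_ccw hr (hD.not_sameDir e)).resolve_right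
    fun h => he ((hD.mem_rayMatching hr).2 h.rotate.rotate)

theorem eq_rotW_or_ccw (hD : D.ProperlyOrdered) (hr : D.IsGenericRay r)
    (hm : m ∈ D.rayMatching r) (h : D.white m = D.white e) :
    m = D.rotW e ∨ Ccw r (D.windingR (D.zigOut e)) (D.windingR (D.zigIn m)) := by
  have hs : D.rotW.SameCycle (D.rotW⁻¹ m) e := D.white_eq_white.1 (by rw [white_rotW_inv, h])
  by_cases hne : D.rotW⁻¹ m = e
  · left; rw [← hne, perm_apply_inv]
  have hfirst := (hD.cyclicallyOrdered_white.not_ccw_of_ccw_apply hs (r := r) (by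
    simpa only [zigOut_rotW_inv, perm_apply_inv] using (hD.mem_rayMatching hr).1 hm)).1
  have hdir := hD.cyclicallyOrdered_white.not_sameDir _ _ hs hne
  exact Or.inr <| (hD.ccw_or_ccw hr hdir).resolve_left fun h => hfirst h.rotate

theorem eq_rotB_or_ccw (hD : D.ProperlyOrdered) (hr : D.IsGenericRay r)
    (hm : m ∈ D.rayMatching r) (h : D.black m = D.black e) :
    m = D.rotB e ∨ Ccw r (D.windingR (D.zigOut e)) (D.windingR (D.zigIn m)) := by
  have hs : D.rotB.SameCycle m (D.rotB e) := D.black_eq_black.1 (by rw [black_rotB, h])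
  by_cases hne : m = D.rotB e
  · exact Or.inl hne
  have hfirst := (hD.cyclicallyOrdered_black.not_ccw_of_ccw_apply hs (r := r) (by
    simpa only [zigIn_rotB] using (hD.mem_rayMatching hr).1 hm)).1
  have hdir := hD.cyclicallyOrdered_black.not_sameDir _ _ hs hne
  rw [zigIn_rotB] at hfirst hdir
  exact Or.inr <| (hD.ccw_or_ccw hr hdir).resolve_left fun h => hfirst h.rotate

end ProperlyOrdered

section LastPath

variable [DecidableEq E] (hD : D.ProperlyOrdered) (hr : D.IsGenericRay r)
  (hM : D.IsPerfectMatching M)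
  (hlast : ∀ m ∈ D.rayMatching r \ M, ¬ Ccw r (D.windingR Z) (D.windingR (D.zigIn m)))

namespace ProperlyOrdered

include hD hr hlast

theorem zigOut_ne_of_mem_rayMatching_sdiff (he : e ∈ D.rayMatching r \ M) : D.zigOut e ≠ Z := by
  rintro rfl
  exact hlast e he ((hD.mem_rayMatching hr).1 (Finset.mem_sdiff.1 he).1).rotate

include hM

theorem rotW_mem_rayMatching_sdiff (he : e ∈ M \ D.rayMatching r) (hZ : D.zigOut e = Z) :
    D.rotW e ∈ D.rayMatching r \ M := by
  obtain ⟨m, hm, hwhite⟩ := hM.exists_mem_sdiff_white (hD.isPerfectMatching_rayMatching hr) he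
  obtain rfl | hc := hD.eq_rotW_or_ccw hr (Finset.mem_sdiff.1 hm).1 hwhite
  · exact hm
  · exact absurd (hZ ▸ hc) (hlast m hm)

theorem rotB_mem_rayMatching_sdiff (he : e ∈ M \ D.rayMatching r) (hZ : D.zigOut e = Z) :
    D.rotB e ∈ D.rayMatching r \ M := by
  obtain ⟨m, hm, hblack⟩ := hM.exists_mem_sdiff_black (hD.isPerfectMatching_rayMatching hr) he
  obtain rfl | hc := hD.eq_rotB_or_ccw hr (Finset.mem_sdiff.1 hm).1 hblack
  · exact hm
  · exact absurd (hZ ▸ hc) (hlast m hm)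

theorem zigIn_ne_of_mem_sdiff_rayMatching (he : e ∈ M \ D.rayMatching r) : D.zigIn e ≠ Z := by
  rintro rfl
  have hccw := hD.ccw_zigIn_zigOut hr (Finset.mem_sdiff.1 he).2
  obtain ⟨m, hm, hwhite⟩ := hM.exists_mem_sdiff_white (hD.isPerfectMatching_rayMatching hr) he
  obtain rfl | hc := hD.eq_rotW_or_ccw hr (Finset.mem_sdiff.1 hm).1 hwhite
  · exact hlast _ hm (by rwa [zigIn_rotW])
  · exact hlast m hm (hccw.trans hc)

theorem card_zigOut_eq_card_zigIn (h : D.totalDisp M = D.totalDisp (D.rayMatching r)) :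
    Finset.card {e ∈ M \ D.rayMatching r | D.zigOut e = Z} =
      Finset.card {e ∈ D.rayMatching r \ M | D.zigIn e = Z} := by
  have sum_sub := hM.sum_crossing_sub_sum_crossing (hD.isPerfectMatching_rayMatching hr) Z
  rw [h, sub_self, ← Finset.sum_sdiff_sub_sum_sdiff] at sum_sub
  have crossing_M (e : E) (he : e ∈ M \ D.rayMatching r) :
      D.crossing Z e = if D.zigOut e = Z then 1 else 0 := by
    rw [crossing, if_neg (hD.zigIn_ne_of_mem_sdiff_rayMatching hr hM hlast he), add_zero]
  have crossing_ray (e : E) (he : e ∈ D.rayMatching r \ M) :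
      D.crossing Z e = if D.zigIn e = Z then 1 else 0 := by
    rw [crossing, if_neg (hD.zigOut_ne_of_mem_rayMatching_sdiff hr hlast he), zero_add]
  rw [Finset.sum_congr rfl crossing_M, Finset.sum_congr rfl crossing_ray, Finset.sum_boole,
    Finset.sum_boole] at sum_sub
  simp only [wedge, Prod.fst_zero, Prod.snd_zero, zero_mul, sub_self] at sum_sub
  omega

/-- The rotations around the nodes match the edges of `M` along `Z` injectively with those of the
other matching; as there are equally many of both, the argument goes all the way along `Z`. -/
theorem mem_sdiff_rayMatching_of_zigOut_eq
    (h : D.totalDisp M = D.totalDisp (D.rayMatching r)) (hm : m ∈ D.rayMatching r \ M)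
    (hmZ : D.zigIn m = Z) (he : D.zigOut e = Z) : e ∈ M \ D.rayMatching r := by
  have card_eq := hD.card_zigOut_eq_card_zigIn hr hM hlast h
  set A : Finset E := {e ∈ M \ D.rayMatching r | D.zigOut e = Z} with hA
  set B : Finset E := {e ∈ D.rayMatching r \ M | D.zigIn e = Z}
  have rotW_mem (e : E) (he : e ∈ A) : D.rotW e ∈ B := by
    rw [hA, Finset.mem_filter] at he
    exact Finset.mem_filter.2
      ⟨hD.rotW_mem_rayMatching_sdiff hr hM hlast he.1 he.2, by rw [zigIn_rotW, he.2]⟩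
  have rotB_mem (e : E) (he : e ∈ A) : D.rotB e ∈ B := by
    rw [hA, Finset.mem_filter] at he
    exact Finset.mem_filter.2
      ⟨hD.rotB_mem_rayMatching_sdiff hr hM hlast he.1 he.2, by rw [zigIn_rotB, he.2]⟩
  have start_mem : D.rotW⁻¹ m ∈ A :=
    inv_apply_mem_of_card_eq rotW_mem card_eq (Finset.mem_filter.2 ⟨hm, hmZ⟩)
  suffices e ∈ A from (Finset.mem_filter.1 this).1
  have hs : D.zigOut (D.rotW⁻¹ m) = D.zigOut e := by rw [zigOut_rotW_inv, hmZ, he]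
  obtain ⟨n, rfl⟩ := (D.zigOut_eq_zigOut.1 hs).exists_nat_pow_eq
  clear hs he
  induction n with
  | zero => exact start_mem
  | succ n ih =>
    rw [pow_succ', Equiv.Perm.mul_apply, zigzagPerm, Equiv.Perm.mul_apply]
    exact inv_apply_mem_of_card_eq rotB_mem card_eq (rotW_mem _ ih)

end ProperlyOrdered

end LastPath

namespace ProperlyOrdered

theorem exists_zigzagPath_of_totalDisp_eq (hD : D.ProperlyOrdered) (hr : D.IsGenericRay r)
    (hM : D.IsPerfectMatching M) (h : D.totalDisp M = D.totalDisp (D.rayMatching r))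
    (hne : M ≠ D.rayMatching r) :
    ∃ Z, (∀ e, D.zigOut e = Z → e ∈ M) ∧ ∀ e, D.zigIn e = Z → e ∈ D.rayMatching r := by
  classical
  have hray := hD.isPerfectMatching_rayMatching hr
  obtain ⟨m, hm, hlast⟩ := exists_last_ccw r (fun e => D.windingR (D.zigIn e))
    (S := (D.rayMatching r \ M : Finset E)) (hray.sdiff_nonempty hM hne.symm)
  have mem_sdiff {e : E} (he : D.zigOut e = D.zigIn m) : e ∈ M \ D.rayMatching r :=
    hD.mem_sdiff_rayMatching_of_zigOut_eq hr hM hlast h hm rfl he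
  refine ⟨D.zigIn m, fun e he => (Finset.mem_sdiff.1 (mem_sdiff he)).1, fun e he => ?_⟩
  have := hD.rotW_mem_rayMatching_sdiff hr hM hlast (mem_sdiff (e := D.rotW⁻¹ e) he) he
  rw [perm_apply_inv] at this
  exact (Finset.mem_sdiff.1 this).1

/-- Otherwise the two matchings contain opposite halves of some path `Z`. Exchanging halves moves
the common point by the winding of `Z` in both directions, out of the half planes that belong to the
windings next to the ray. -/
theorem eq_rayMatching_of_totalDisp_eq (hD : D.ProperlyOrdered) (hr : D.IsGenericRay r)
    (hM : D.IsPerfectMatching M) (h : D.totalDisp M = D.totalDisp (D.rayMatching r)) :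
    M = D.rayMatching r := by
  by_contra hne
  obtain ⟨Z, hout, hin⟩ := hD.exists_zigzagPath_of_totalDisp_eq hr hM h hne
  obtain ⟨M₁, hM₁, add_eq⟩ := hD.exists_totalDisp_eq_add hM hout
  obtain ⟨M₂, hM₂, sub_eq⟩ :=
    hD.exists_totalDisp_eq_sub (hD.isPerfectMatching_rayMatching hr) hin
  obtain ⟨Z₁, hZ₁⟩ := D.exists_isFirstCw r
  obtain ⟨Z₂, hZ₂⟩ := D.exists_isFirstCcw r
  have wedge_eq_zero {Y : D.ZigzagPath} (hY : ∀ {M}, D.IsPerfectMatching M →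
      0 ≤ wedge (D.winding Y) (D.totalDisp M - D.totalDisp (D.rayMatching r))) :
      wedge (D.winding Y) (D.winding Z) = 0 := by
    have nonneg := hY hM₁
    have nonpos := hY hM₂
    rw [add_eq, h, add_sub_cancel_left] at nonneg
    rw [sub_eq, sub_sub_cancel_left, ← neg_one_smul ℤ, wedge_smul_right] at nonpos
    omega
  have wedge_ne := (hD.wedge_pos_of_isFirst hr hZ₁ hZ₂).ne'
  rw [windingR, windingR, wedge_toReal, Int.cast_ne_zero] at wedge_ne
  exact hD.winding_ne_zero Z (eq_zero_of_wedge_eq_zero wedge_ne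
    (wedge_eq_zero (hD.wedge_nonneg_of_isFirstCw hr hZ₁))
    (wedge_eq_zero (hD.wedge_nonneg_of_isFirstCcw hr hZ₂)))

end ProperlyOrdered

end Dimer

/-! ### Faces of a planar convex set -/

/-- The points of `Δ` that lie furthest to the right of the direction `u`: the edge or corner of a
polygon that is tangent to `u` when the boundary is traversed counterclockwise. -/
def minFace (Δ : Set (ℝ × ℝ)) (u : ℝ × ℝ) : Set (ℝ × ℝ) :=
  {x | x ∈ Δ ∧ ∀ y ∈ Δ, wedge u x ≤ wedge u y}

section MinFace

variable {Δ S : Set (ℝ × ℝ)} {u v x : ℝ × ℝ}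

theorem exists_eq_wedge (f : StrongDual ℝ (ℝ × ℝ)) : ∃ u, ∀ x, f x = wedge u x := by
  refine ⟨(f (0, 1), -f (1, 0)), fun x => ?_⟩
  have decomposition : x = x.1 • ((1, 0) : ℝ × ℝ) + x.2 • ((0, 1) : ℝ × ℝ) := by ext <;> simp
  conv_lhs => rw [decomposition]
  simp only [map_add, map_smul, smul_eq_mul, wedge]
  ring

theorem convex_wedge_ge (u : ℝ × ℝ) (a : ℝ) : Convex ℝ {x | a ≤ wedge u x} := by
  intro x hx y hy s t hs ht hst
  simp only [Set.mem_ofPred_eq] at hx hy ⊢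
  rw [wedge_add_right, wedge_smul_right, wedge_smul_right]
  calc a = s * a + t * a := by rw [← add_mul, hst, one_mul]
    _ ≤ _ := by gcongr

theorem le_wedge_of_mem_convexHull {a : ℝ} (h : ∀ x ∈ S, a ≤ wedge u x)
    (hx : x ∈ convexHull ℝ S) : a ≤ wedge u x :=
  convexHull_min h (convex_wedge_ge u a) hx

theorem isExtreme_minFace (Δ : Set (ℝ × ℝ)) (u : ℝ × ℝ) : IsExtreme ℝ Δ (minFace Δ u) := by
  refine ⟨fun x hx => hx.1, fun x hx y hy z hz hxy => ⟨hx, fun q hq => ?_⟩⟩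
  obtain ⟨s, t, hs, ht, hst, rfl⟩ := hxy
  refine le_trans ?_ (hz.2 q hq)
  have h := hz.2 y hy
  rw [wedge_add_right, wedge_smul_right, wedge_smul_right] at h ⊢
  obtain rfl : t = 1 - s := by linarith
  nlinarith

theorem wedge_le_wedge_of_sameDir {x y : ℝ × ℝ} (h : SameDir u v) (hu : u ≠ 0)
    (hxy : wedge u x ≤ wedge u y) : wedge v x ≤ wedge v y := by
  have hx := normSq_mul_wedge u v x
  have hy := normSq_mul_wedge u v y
  rw [h.1, mul_zero, sub_zero] at hx hy
  refine le_of_mul_le_mul_left ?_ (normSq_pos hu)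
  rw [hx, hy]
  exact mul_le_mul_of_nonneg_left hxy h.2.le

theorem minFace_subset_of_sameDir (h : SameDir u v) (hu : u ≠ 0) :
    minFace Δ u ⊆ minFace Δ v :=
  fun _ hx => ⟨hx.1, fun y hy => wedge_le_wedge_of_sameDir h hu (hx.2 y hy)⟩

theorem wedge_eq_of_mem_minFace {x y : ℝ × ℝ} (hx : x ∈ minFace Δ u) (hy : y ∈ minFace Δ u) :
    wedge u x = wedge u y :=
  (hx.2 y hy.1).antisymm (hy.2 x hx.1)

theorem convex_minFace (hΔ : Convex ℝ Δ) (u : ℝ × ℝ) : Convex ℝ (minFace Δ u) :=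
  fun x hx y hy s t hs ht hst => ⟨hΔ hx.1 hy.1 hs ht hst, fun z hz => by
    rw [wedge_add_right, wedge_smul_right, wedge_smul_right, wedge_eq_of_mem_minFace hy hx,
      ← add_mul, hst, one_mul]
    exact hx.2 z hz⟩

/-- The half planes to the left of `a` and of `b` intersect in a cone with apex `x` that is strictly
to the left of every direction between `a` and `b`. -/
theorem minFace_eq_singleton {a b : ℝ × ℝ} (hab : 0 < wedge a b) (hau : 0 < wedge a u)
    (hub : 0 < wedge u b) (ha : x ∈ minFace Δ a) (hb : x ∈ minFace Δ b) :
    minFace Δ u = {x} := by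
  have decomposition (y : ℝ × ℝ) :
      wedge a b * wedge u (y - x) = wedge a u * wedge b (y - x) + wedge u b * wedge a (y - x) := by
    simp only [wedge]; ring
  have left_a {y} (hy : y ∈ Δ) : 0 ≤ wedge u b * wedge a (y - x) := by
    rw [wedge_sub_right]; exact mul_nonneg hub.le (sub_nonneg.2 (ha.2 y hy))
  have left_b {y} (hy : y ∈ Δ) : 0 ≤ wedge a u * wedge b (y - x) := by
    rw [wedge_sub_right]; exact mul_nonneg hau.le (sub_nonneg.2 (hb.2 y hy))
  have hx : x ∈ minFace Δ u := ⟨ha.1, fun y hy => by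
    rw [← sub_nonneg, ← wedge_sub_right]
    refine nonneg_of_mul_nonneg_right ?_ hab
    rw [decomposition]
    exact add_nonneg (left_b hy) (left_a hy)⟩
  refine Set.eq_singleton_iff_unique_mem.2 ⟨hx, fun y hy => ?_⟩
  have sum_eq_zero := decomposition y
  rw [wedge_sub_right u, wedge_eq_of_mem_minFace hy hx, sub_self, mul_zero, eq_comm,
    add_eq_zero_iff_of_nonneg (left_b hy.1) (left_a hy.1)] at sum_eq_zero
  exact sub_eq_zero.1 (eq_zero_of_wedge_eq_zero hab.ne'
    ((mul_eq_zero.1 sum_eq_zero.2).resolve_left hub.ne')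
    ((mul_eq_zero.1 sum_eq_zero.1).resolve_left hau.ne'))

theorem minFace_eq_segment (hΔ : Convex ℝ Δ) {a b p q : ℝ × ℝ} (hau : 0 < wedge a u)
    (hub : 0 < wedge u b) (hp : p ∈ minFace Δ u) (hq : q ∈ minFace Δ u) (ha : p ∈ minFace Δ a)
    (hb : q ∈ minFace Δ b) : minFace Δ u = segment ℝ p q := by
  refine Set.Subset.antisymm (fun x hx => ?_) ((convex_minFace hΔ u).segment_subset hp hq)
  let s (y : ℝ × ℝ) : ℝ := wedge a (y - p) / wedge a u
  have eq_add_smul {y} (hy : y ∈ minFace Δ u) : y = p + s y • u := by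
    have hs : y - p - s y • u = 0 := eq_zero_of_wedge_eq_zero hau.ne'
      (by rw [wedge_sub_right, wedge_smul_right, div_mul_cancel₀ _ hau.ne', sub_self])
      (by rw [wedge_sub_right, wedge_sub_right, wedge_smul_right, wedge_self, mul_zero, sub_zero,
        wedge_eq_of_mem_minFace hy hp, sub_self])
    rw [← sub_eq_zero, ← sub_sub, hs]
  have hs₀ : 0 ≤ s x := by
    refine div_nonneg ?_ hau.le
    rw [wedge_sub_right]; exact sub_nonneg.2 (ha.2 x hx.1)
  have hs₁ : s x ≤ s q := by
    have := hb.2 x hx.1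
    rw [eq_add_smul hx, eq_add_smul hq, wedge_add_right, wedge_add_right, wedge_smul_right,
      wedge_smul_right, wedge_swap u b] at this
    refine le_of_mul_le_mul_right ?_ hub
    linarith
  rw [segment_eq_image']
  refine ⟨s x / s q, ⟨div_nonneg hs₀ (hs₀.trans hs₁), div_le_one_of_le₀ hs₁ (hs₀.trans hs₁)⟩, ?_⟩
  have hq_sub : q - p = s q • u := by rw [sub_eq_iff_eq_add', ← eq_add_smul hq]
  have cancel : s x / s q * s q = s x := div_mul_cancel_of_imp fun h => by linarith
  change p + (s x / s q) • (q - p) = x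
  rw [hq_sub, smul_smul, cancel, ← eq_add_smul hx]

theorem eq_convexHull_of_forall_exists_mem_minFace (hΔ : Convex ℝ Δ) (hS : S.Finite)
    (hSΔ : S ⊆ Δ) (h : ∀ u ≠ 0, ∃ x ∈ S, x ∈ minFace Δ u) : Δ = convexHull ℝ S := by
  refine (convexHull_min hSΔ hΔ).antisymm' fun x hx => by_contra fun hxS => ?_
  obtain ⟨f, a, hfx, hfS⟩ :=
    geometric_hahn_banach_point_closed (convex_convexHull ℝ S) (hS.isClosed_convexHull ℝ) hxS
  obtain ⟨u, hu⟩ := exists_eq_wedge f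
  have lt_of_mem {p : ℝ × ℝ} (hp : p ∈ S) : wedge u x < wedge u p := by
    rw [← hu, ← hu]
    exact hfx.trans (hfS p (subset_convexHull ℝ S hp))
  obtain rfl | hu0 := eq_or_ne u 0
  · obtain ⟨p, hp, -⟩ := h (1, 0) (by simp)
    simpa [wedge] using lt_of_mem hp
  · obtain ⟨p, hp, hmin⟩ := h u hu0
    exact (lt_of_mem hp).not_ge (hmin.2 x hx)

theorem extremePoints_eq_of_minFace (hΔ : Convex ℝ Δ) (hS : S.Finite)
    (h : ∀ u ≠ 0, ∃ x ∈ S, x ∈ minFace Δ u) (hS' : ∀ x ∈ S, ∃ u, minFace Δ u = {x}) :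
    Δ.extremePoints ℝ = S := by
  have extreme : S ⊆ Δ.extremePoints ℝ := fun x hx => by
    obtain ⟨u, hu⟩ := hS' x hx
    exact isExtreme_singleton.1 (hu ▸ isExtreme_minFace Δ u)
  have hull := eq_convexHull_of_forall_exists_mem_minFace hΔ hS
    (extreme.trans fun x hx => hx.1) h
  refine subset_antisymm ?_ extreme
  conv_lhs => rw [hull]
  exact extremePoints_convexHull_subset

end MinFace

/-! ### Rays next to a lattice direction -/

section AdjacentRays

variable {a d : ℤ} {t : ℝ}

theorem intCast_add_mul_ne_zero (ht : t ≠ 0) (hd : |t * d| < 1) (h : a = 0 → d ≠ 0) :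
    (a : ℝ) + t * d ≠ 0 := by
  intro h0
  have ha : a = 0 := by
    rw [← Int.abs_lt_one_iff, ← Int.cast_lt (R := ℝ), Int.cast_abs, Int.cast_one,
      eq_neg_of_add_eq_zero_left h0, abs_neg]
    exact hd
  rw [ha, Int.cast_zero, zero_add] at h0
  exact mul_ne_zero ht (Int.cast_ne_zero.2 (h ha)) h0

theorem intCast_add_mul_pos_and_iff (ht : 0 < t) (hd : |t * d| < 1) :
    0 < (a : ℝ) + t * d ∧ 0 < -(a : ℝ) + t * d ↔ a = 0 ∧ 0 < d := by
  constructor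
  · rintro ⟨h₁, h₂⟩
    have ha : a = 0 := by
      rw [← Int.abs_lt_one_iff, ← Int.cast_lt (R := ℝ), Int.cast_abs, Int.cast_one, abs_lt]
      constructor <;> linarith [(abs_lt.1 hd).2]
    rw [ha, Int.cast_zero, zero_add] at h₁
    exact ⟨ha, Int.cast_pos.1 (pos_of_mul_pos_right h₁ ht.le)⟩
  · rintro ⟨rfl, hd⟩
    have : 0 < t * d := mul_pos ht (Int.cast_pos.2 hd)
    simpa using this

theorem exists_pos_forall_abs_mul_lt_one {ι : Type*} [Finite ι] (f : ι → ℤ) :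
    ∃ t : ℝ, 0 < t ∧ ∀ i, |t * f i| < 1 := by
  obtain ⟨K, hK⟩ := Set.finite_range (fun i => |(f i : ℝ)|) |>.bddAbove
  have hK' (i : ι) : |(f i : ℝ)| < |K| + 1 :=
    (hK ⟨i, rfl⟩).trans_lt ((le_abs_self K).trans_lt (lt_add_one _))
  have hpos : 0 < |K| + 1 := by positivity
  refine ⟨(|K| + 1)⁻¹, inv_pos.2 hpos, fun i => ?_⟩
  rw [abs_mul, abs_of_pos (inv_pos.2 hpos), inv_mul_lt_iff₀ hpos, mul_one]
  exact hK' i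

theorem exists_adjacent_rays {ι : Type*} [Finite ι] {w : ℤ × ℤ} (hw : w ≠ 0) {V : ι → ℤ × ℤ}
    (hV : ∀ i, V i ≠ 0) :
    ∃ r₁ r₂ : ℝ × ℝ, r₁ ≠ 0 ∧ r₂ ≠ 0 ∧ (∀ i, ¬ SameDir r₁ (toReal (V i))) ∧
      (∀ i, ¬ SameDir r₂ (toReal (V i))) ∧ ∀ i, Ccw r₁ (toReal (V i)) r₂ ↔ SameDir w (V i) := by
  let dot (v : ℤ × ℤ) : ℤ := w.1 * v.1 + w.2 * v.2
  obtain ⟨t, ht, hsmall⟩ := exists_pos_forall_abs_mul_lt_one fun i => dot (V i)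
  let n : ℝ × ℝ := (-w.2, w.1)
  have wedge_r₁ (v : ℤ × ℤ) :
      wedge (toReal w - t • n) (toReal v) = (wedge w v : ℤ) + t * dot v := by
    simp [wedge, toReal, n, dot]; ring
  have wedge_r₂ (v : ℤ × ℤ) :
      wedge (toReal v) (toReal w + t • n) = -(wedge w v : ℤ) + t * dot v := by
    simp [wedge, toReal, n, dot]; ring
  have r₁_wedge_r₂ : 0 < wedge (toReal w - t • n) (toReal w + t • n) := by
    have normSq : 0 < (w.1 * w.1 + w.2 * w.2 : ℝ) := mod_cast normSq_pos hw
    calc (0 : ℝ) < 2 * t * (w.1 * w.1 + w.2 * w.2) := by positivity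
      _ = _ := by simp [wedge, toReal, n]; ring
  have dot_ne_zero (i : ι) (h : wedge w (V i) = 0) : dot (V i) ≠ 0 := fun hdot => by
    have lagrange := normSq_mul_dot w (V i) (V i)
    rw [h, show w.1 * (V i).1 + w.2 * (V i).2 = 0 from hdot, mul_zero, add_zero] at lagrange
    exact (mul_pos (normSq_pos hw) (normSq_pos (hV i))).ne' lagrange
  refine ⟨toReal w - t • n, toReal w + t • n, ?_, ?_, fun i h => ?_, fun i h => ?_, fun i => ?_⟩
  · rintro h; simp [h, wedge] at r₁_wedge_r₂
  · rintro h; simp [h, wedge] at r₁_wedge_r₂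
  · exact intCast_add_mul_ne_zero ht.ne' (hsmall i) (dot_ne_zero i) (wedge_r₁ (V i) ▸ h.1)
  · have h' := h.symm.1
    rw [wedge_r₂, ← Int.cast_neg] at h'
    exact intCast_add_mul_ne_zero ht.ne' (hsmall i) (fun h => dot_ne_zero i (neg_eq_zero.1 h)) h'
  · calc Ccw (toReal w - t • n) (toReal (V i)) (toReal w + t • n)
        ↔ 0 < wedge (toReal w - t • n) (toReal (V i)) ∧
            0 < wedge (toReal (V i)) (toReal w + t • n) :=
          ⟨fun h => h.wedge_pos r₁_wedge_r₂.le, Or.inl⟩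
      _ ↔ wedge w (V i) = 0 ∧ 0 < dot (V i) := by
          rw [wedge_r₁, wedge_r₂, intCast_add_mul_pos_and_iff ht (hsmall i)]

end AdjacentRays

/-! ### Legs on an edge -/

section Legs

variable {Δ : Set (ℝ × ℝ)} {p q w : ℤ × ℤ} {n : ℕ}

theorem toReal_nsmul (n : ℕ) (u : ℤ × ℤ) : toReal (n • u) = (n : ℝ) • toReal u := by
  simp [toReal]

theorem toReal_add_nsmul_mem_segment {k : ℕ} (hk : k ≤ n) :
    toReal (q + k • w) ∈ segment ℝ (toReal q) (toReal (q + n • w)) := by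
  simp only [toReal_add, toReal_nsmul]
  obtain rfl | hn := n.eq_zero_or_pos
  · simp [Nat.le_zero.1 hk]
  have hn' : (0 : ℝ) < n := Nat.cast_pos.2 hn
  rw [segment_eq_image']
  refine ⟨k / n, ⟨by positivity, (div_le_one hn').2 (Nat.cast_le.2 hk)⟩, ?_⟩
  simp only [add_sub_cancel_left, smul_smul, div_mul_cancel₀ _ hn'.ne']

theorem toReal_mem_segment_iff (hw : IsCoprime w.1 w.2) :
    toReal p ∈ segment ℝ (toReal q) (toReal (q + n • w)) ↔ ∃ k ≤ n, p = q + k • w := by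
  refine ⟨fun hp => ?_, fun ⟨k, hk, h⟩ => h ▸ toReal_add_nsmul_mem_segment hk⟩
  rw [segment_eq_image', toReal_add, add_sub_cancel_left, toReal_nsmul] at hp
  obtain ⟨θ, ⟨hθ₀, hθ₁⟩, hθ : toReal q + θ • (n : ℝ) • toReal w = toReal p⟩ := hp
  have sub_eq : toReal (p - q) = (θ * n) • toReal w := by
    rw [toReal_sub, ← hθ, add_sub_cancel_left, smul_smul]
  have wedge_eq : wedge w (p - q) = 0 := by
    rw [← Int.cast_eq_zero (α := ℝ), ← wedge_toReal, sub_eq, wedge_smul_right, wedge_self, mul_zero]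
  obtain ⟨t, ht⟩ := exists_eq_smul_of_wedge_eq_zero hw wedge_eq
  rw [ht, toReal_zsmul] at sub_eq
  have t_eq : (t : ℝ) = θ * n :=
    smul_left_injective ℝ (toReal_ne_zero (ne_zero_of_isCoprime hw)) sub_eq
  have ht₀ : 0 ≤ t := by rw [← Int.cast_nonneg_iff (R := ℝ), t_eq]; positivity
  have ht₁ : t ≤ n := by
    rw [← Int.cast_le (R := ℝ), t_eq, Int.cast_natCast]
    exact mul_le_of_le_one_left n.cast_nonneg hθ₁
  lift t to ℕ using ht₀
  exact ⟨t, mod_cast ht₁, by rw [← natCast_zsmul, ← ht, add_sub_cancel]⟩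

namespace Leg

theorem src_mem_minFace (l : Leg Δ) : toReal l.src ∈ minFace Δ (toReal (l.tgt - l.src)) := by
  refine ⟨l.src_mem, fun y hy => ?_⟩
  have := l.boundary y hy
  rw [wedge_sub_right] at this
  rw [toReal_sub]
  linarith

theorem tgt_mem_minFace (l : Leg Δ) : toReal l.tgt ∈ minFace Δ (toReal (l.tgt - l.src)) := by
  refine ⟨l.tgt_mem, fun y hy => le_of_eq_of_le ?_ (l.src_mem_minFace.2 y hy)⟩
  rw [← sub_eq_zero, ← wedge_sub_right, ← toReal_sub, wedge_self]

theorem tgt_sub_src_eq (l : Leg Δ) (h : l.tgt - l.src = n • w) : l.tgt - l.src = w := by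
  have tgt_eq : l.tgt = l.src + n • w := by rw [← h, add_sub_cancel]
  have hn : n ≠ 0 := fun hn => l.ne (by rw [tgt_eq, hn, zero_smul, add_zero])
  have mem_segment := toReal_add_nsmul_mem_segment (q := l.src) (w := w)
    (Nat.one_le_iff_ne_zero.2 hn)
  rw [← tgt_eq, one_smul] at mem_segment
  obtain hw | hw := l.consecutive _ mem_segment
  · rw [h, add_eq_left.1 hw, smul_zero]
  · rw [← hw, add_sub_cancel_left]

theorem exists_of_mem_minFace (hw : IsCoprime w.1 w.2) (hp : toReal p ∈ minFace Δ (toReal w))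
    (hpw : toReal (p + w) ∈ Δ) : ∃ l : Leg Δ, l.src = p ∧ l.tgt = p + w := by
  refine ⟨⟨p, p + w, hp.1, hpw, ?_, fun x hx => ?_, fun p' hp' => ?_⟩, rfl, rfl⟩
  · simpa using ne_zero_of_isCoprime hw
  · rw [← toReal_sub, add_sub_cancel_left, wedge_sub_right]
    exact sub_nonneg.2 (hp.2 x hx)
  · rw [← one_smul ℕ w, toReal_mem_segment_iff hw] at hp'
    obtain ⟨k, hk, rfl⟩ := hp'
    interval_cases k <;> simp

theorem nonempty_fin_equiv (hw : IsCoprime w.1 w.2)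
    (hface : minFace Δ (toReal w) = segment ℝ (toReal q) (toReal (q + n • w))) :
    Nonempty (Fin n ≃ {l : Leg Δ // l.tgt - l.src = w}) := by
  have mem_face {k : ℕ} (hk : k ≤ n) : toReal (q + k • w) ∈ minFace Δ (toReal w) :=
    hface ▸ toReal_add_nsmul_mem_segment hk
  have hleg (k : Fin n) : ∃ l : Leg Δ, l.src = q + (k : ℕ) • w ∧ l.tgt = q + (k : ℕ) • w + w :=
    exists_of_mem_minFace hw (mem_face k.2.le) (by
      rw [add_assoc, ← succ_nsmul]; exact (mem_face k.2).1)
  choose f hsrc htgt using hleg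
  have hvec (k : Fin n) : (f k).tgt - (f k).src = w := by rw [hsrc, htgt, add_sub_cancel_left]
  have nsmul_inj {k m : ℕ} (h : q + k • w = q + m • w) : k = m := by
    rw [add_right_inj, ← natCast_zsmul, ← natCast_zsmul] at h
    exact_mod_cast smul_left_injective ℤ (ne_zero_of_isCoprime hw) h
  refine ⟨Equiv.ofBijective (fun k => ⟨f k, hvec k⟩) ⟨fun k m hkm => ?_, fun ⟨l, hl⟩ => ?_⟩⟩
  · have : (f k).src = (f m).src := congrArg (fun l => l.1.src) hkm
    exact Fin.ext (nsmul_inj (by rwa [hsrc, hsrc] at this))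
  · have hs := l.src_mem_minFace
    have ht := l.tgt_mem_minFace
    rw [hl, hface, toReal_mem_segment_iff hw] at hs ht
    obtain ⟨k, -, hk⟩ := hs
    obtain ⟨m, hm, hm'⟩ := ht
    have m_eq : m = k + 1 := nsmul_inj <| by
      rw [← hm', succ_nsmul, ← add_assoc, ← hk, ← hl, add_sub_cancel]
    refine ⟨⟨k, by omega⟩, Subtype.ext (Leg.ext ?_ ?_)⟩
    · rw [hsrc, hk]
    · rw [htgt, ← hk]
      exact (sub_eq_iff_eq_add'.1 hl).symm

theorem exists_equiv {ι : Type*} [Finite ι] {w : ι → ℤ × ℤ}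
    (hw : ∀ i, IsCoprime (w i).1 (w i).2)
    (hedge : ∀ i, ∃ q, minFace Δ (toReal (w i)) =
      segment ℝ (toReal q) (toReal (q + Nat.card {j // w j = w i} • w i)))
    (hcorner : ∀ u ≠ 0, (minFace Δ (toReal u)).Subsingleton ∨ ∃ i, ∃ n : ℕ, u = n • w i) :
    ∃ Φ : ι ≃ Leg Δ, ∀ i, (Φ i).tgt - (Φ i).src = w i := by
  have fiber (v : ℤ × ℤ) : Nonempty ({i // w i = v} ≃ {l : Leg Δ // l.tgt - l.src = v}) := by
    by_cases hv : ∃ i, w i = v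
    · obtain ⟨i, rfl⟩ := hv
      obtain ⟨q, hq⟩ := hedge i
      obtain ⟨Ψ⟩ := nonempty_fin_equiv (hw i) hq
      exact ⟨(Finite.equivFin _).trans Ψ⟩
    · have : IsEmpty {i // w i = v} := ⟨fun i => hv ⟨i.1, i.2⟩⟩
      have : IsEmpty {l : Leg Δ // l.tgt - l.src = v} := ⟨fun ⟨l, hl⟩ => by
        obtain h | ⟨i, n, hi⟩ := hcorner (l.tgt - l.src) (sub_ne_zero.2 l.ne.symm)
        · exact l.ne (toReal_injective (h l.src_mem_minFace l.tgt_mem_minFace))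
        · exact hv ⟨i, (l.tgt_sub_src_eq hi).symm.trans hl⟩⟩
      exact ⟨Equiv.equivOfIsEmpty _ _⟩
  exact ⟨Equiv.ofFiberEquiv fun v => (fiber v).some,
    Equiv.ofFiberEquiv_map (g := fun l : Leg Δ => l.tgt - l.src) _⟩

end Leg

end Legs

/-! ### The polygon of total displacements -/

namespace Dimer

variable {E : Type*} [Fintype E] {D : Dimer E} {r r₁ r₂ : ℝ × ℝ} {w : ℤ × ℤ}
  {Z Z₁ Z₂ : D.ZigzagPath}

variable (D) in
/-- The convex hull of the total displacements of all perfect matchings: the toric diagram before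
curves `γ_w` and `γ_z` are chosen. -/
def dispPolygon : Set (ℝ × ℝ) :=
  convexHull ℝ {x | ∃ M, D.IsPerfectMatching M ∧ x = toReal (D.totalDisp M)}

variable (D) in
theorem finite_totalDisp_rayMatching :
    {x | ∃ r, D.IsGenericRay r ∧ x = toReal (D.totalDisp (D.rayMatching r))}.Finite := by
  refine (Set.finite_range fun M : Finset E => toReal (D.totalDisp M)).subset ?_
  rintro _ ⟨r, -, rfl⟩
  exact ⟨_, rfl⟩

theorem IsPerfectMatching.toReal_totalDisp_mem {M : Finset E} (hM : D.IsPerfectMatching M) :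
    toReal (D.totalDisp M) ∈ D.dispPolygon :=
  subset_convexHull ℝ _ ⟨M, hM, rfl⟩

theorem isFirstCcw_of_between (h : ∀ Z, Ccw r₁ (D.windingR Z) r₂ ↔ D.winding Z = w)
    (hZ : D.winding Z = w) : D.IsFirstCcw r₁ Set.univ Z := fun Y _ hY => by
  have hYw := (h Y).1 (hY.trans ((h Z).2 hZ))
  rw [windingR, windingR, hYw, hZ] at hY
  exact not_ccw_self_right _ _ hY

theorem isFirstCw_of_between (h : ∀ Z, Ccw r₁ (D.windingR Z) r₂ ↔ D.winding Z = w)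
    (hZ : D.winding Z = w) : D.IsFirstCw r₂ Set.univ Z := fun Y _ hY => by
  have hYw := (h Y).1 (((h Z).2 hZ).rotate.rotate.trans hY.rotate.rotate).rotate
  rw [windingR, windingR, hYw, hZ] at hY
  exact not_ccw_self_right _ _ hY.rotate.rotate

namespace ProperlyOrdered

theorem exists_isGenericRay_adjacent (hD : D.ProperlyOrdered) (Z : D.ZigzagPath) :
    ∃ r₁ r₂, D.IsGenericRay r₁ ∧ D.IsGenericRay r₂ ∧
      ∀ Y, Ccw r₁ (D.windingR Y) r₂ ↔ D.winding Y = D.winding Z := by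
  obtain ⟨r₁, r₂, h₁, h₂, hr₁, hr₂, h⟩ :=
    exists_adjacent_rays (hD.winding_ne_zero Z) hD.winding_ne_zero
  refine ⟨r₁, r₂, ⟨h₁, hr₁⟩, ⟨h₂, hr₂⟩, fun Y => (h Y).trans ?_⟩
  rw [← sameDir_toReal]
  exact hD.sameDir_windingR.trans eq_comm

theorem toReal_totalDisp_rayMatching_mem (hD : D.ProperlyOrdered) (hr : D.IsGenericRay r) :
    toReal (D.totalDisp (D.rayMatching r)) ∈ D.dispPolygon :=
  (hD.isPerfectMatching_rayMatching hr).toReal_totalDisp_mem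

theorem mem_minFace_of_isFirstCcw (hD : D.ProperlyOrdered) (hr : D.IsGenericRay r)
    (hZ : D.IsFirstCcw r Set.univ Z) :
    toReal (D.totalDisp (D.rayMatching r)) ∈ minFace D.dispPolygon (D.windingR Z) := by
  refine ⟨hD.toReal_totalDisp_rayMatching_mem hr, fun x => le_wedge_of_mem_convexHull ?_⟩
  rintro _ ⟨M, hM, rfl⟩
  rw [← sub_nonneg, ← wedge_sub_right, ← toReal_sub, windingR, wedge_toReal]
  exact_mod_cast hD.wedge_nonneg_of_isFirstCcw hr hZ hM

theorem mem_minFace_of_isFirstCw (hD : D.ProperlyOrdered) (hr : D.IsGenericRay r)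
    (hZ : D.IsFirstCw r Set.univ Z) :
    toReal (D.totalDisp (D.rayMatching r)) ∈ minFace D.dispPolygon (D.windingR Z) := by
  refine ⟨hD.toReal_totalDisp_rayMatching_mem hr, fun x => le_wedge_of_mem_convexHull ?_⟩
  rintro _ ⟨M, hM, rfl⟩
  rw [← sub_nonneg, ← wedge_sub_right, ← toReal_sub, windingR, wedge_toReal]
  exact_mod_cast hD.wedge_nonneg_of_isFirstCw hr hZ hM

theorem ccw_of_isFirst (hD : D.ProperlyOrdered) (hr : D.IsGenericRay r)
    (h₁ : D.IsFirstCw r Set.univ Z₁) (h₂ : D.IsFirstCcw r Set.univ Z₂) :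
    Ccw (D.windingR Z₁) r (D.windingR Z₂) := by
  have hne : ¬ SameDir (D.windingR Z₁) (D.windingR Z₂) := fun h =>
    (hD.wedge_pos_of_isFirst hr h₁ h₂).ne' h.1
  exact ((hD.ccw_or_ccw hr hne).resolve_left (h₂ Z₁ trivial)).rotate.rotate

theorem minFace_dispPolygon_of_isGenericRay (hD : D.ProperlyOrdered) (hr : D.IsGenericRay r) :
    minFace D.dispPolygon r = {toReal (D.totalDisp (D.rayMatching r))} := by
  obtain ⟨Z₁, h₁⟩ := D.exists_isFirstCw r
  obtain ⟨Z₂, h₂⟩ := D.exists_isFirstCcw r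
  have h₁₂ := hD.wedge_pos_of_isFirst hr h₁ h₂
  obtain ⟨h₁r, hr₂⟩ := (hD.ccw_of_isFirst hr h₁ h₂).wedge_pos h₁₂.le
  exact minFace_eq_singleton h₁₂ h₁r hr₂ (hD.mem_minFace_of_isFirstCw hr h₁)
    (hD.mem_minFace_of_isFirstCcw hr h₂)

theorem minFace_dispPolygon_eq_segment (hD : D.ProperlyOrdered) (h₁ : D.IsGenericRay r₁)
    (h₂ : D.IsGenericRay r₂) (hw : ∃ Z, D.winding Z = w)
    (h : ∀ Z, Ccw r₁ (D.windingR Z) r₂ ↔ D.winding Z = w) :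
    minFace D.dispPolygon (toReal w) = segment ℝ (toReal (D.totalDisp (D.rayMatching r₁)))
      (toReal (D.totalDisp (D.rayMatching r₂))) := by
  obtain ⟨Z, rfl⟩ := hw
  obtain ⟨Z₁, hZ₁⟩ := D.exists_isFirstCw r₁
  obtain ⟨Z₂, hZ₂⟩ := D.exists_isFirstCcw r₂
  have hZ_ccw := isFirstCcw_of_between h rfl
  have hZ_cw := isFirstCw_of_between h rfl
  exact minFace_eq_segment (convex_convexHull ℝ _) (hD.wedge_pos_of_isFirst h₁ hZ₁ hZ_ccw)
    (hD.wedge_pos_of_isFirst h₂ hZ_cw hZ₂) (hD.mem_minFace_of_isFirstCcw h₁ hZ_ccw)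
    (hD.mem_minFace_of_isFirstCw h₂ hZ_cw) (hD.mem_minFace_of_isFirstCw h₁ hZ₁)
    (hD.mem_minFace_of_isFirstCcw h₂ hZ₂)

theorem exists_mem_minFace_dispPolygon (hD : D.ProperlyOrdered) {u : ℝ × ℝ} (hu : u ≠ 0) :
    ∃ r, D.IsGenericRay r ∧
      toReal (D.totalDisp (D.rayMatching r)) ∈ minFace D.dispPolygon u := by
  by_cases hgen : D.IsGenericRay u
  · exact ⟨u, hgen, by rw [hD.minFace_dispPolygon_of_isGenericRay hgen, Set.mem_singleton_iff]⟩
  · obtain ⟨Z, hZ⟩ : ∃ Z, SameDir u (D.windingR Z) := by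
      by_contra! h; exact hgen ⟨hu, h⟩
    obtain ⟨r₁, r₂, h₁, -, h⟩ := hD.exists_isGenericRay_adjacent Z
    exact ⟨r₁, h₁, minFace_subset_of_sameDir hZ.symm (hD.windingR_ne_zero Z)
      (hD.mem_minFace_of_isFirstCcw h₁ (isFirstCcw_of_between h rfl))⟩

theorem extremePoints_dispPolygon (hD : D.ProperlyOrdered) :
    D.dispPolygon.extremePoints ℝ =
      {x | ∃ r, D.IsGenericRay r ∧ x = toReal (D.totalDisp (D.rayMatching r))} := by
  refine extremePoints_eq_of_minFace (convex_convexHull ℝ _) D.finite_totalDisp_rayMatching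
    (fun u hu => ?_) ?_
  · obtain ⟨r, hr, hmem⟩ := hD.exists_mem_minFace_dispPolygon hu
    exact ⟨_, ⟨r, hr, rfl⟩, hmem⟩
  · rintro _ ⟨r, hr, rfl⟩
    exact ⟨r, hD.minFace_dispPolygon_of_isGenericRay hr⟩

theorem dispPolygon_eq_convexHull (hD : D.ProperlyOrdered) :
    D.dispPolygon = convexHull ℝ
      {x | ∃ r, D.IsGenericRay r ∧ x = toReal (D.totalDisp (D.rayMatching r))} := by
  refine eq_convexHull_of_forall_exists_mem_minFace (convex_convexHull ℝ _)
    D.finite_totalDisp_rayMatching ?_ fun u hu => ?_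
  · rintro _ ⟨r, hr, rfl⟩
    exact hD.toReal_totalDisp_rayMatching_mem hr
  · obtain ⟨r, hr, hmem⟩ := hD.exists_mem_minFace_dispPolygon hu
    exact ⟨_, ⟨r, hr, rfl⟩, hmem⟩

end ProperlyOrdered

end Dimer

/-! ### The determinant of the Kasteleyn matrix -/

namespace Dimer

variable {E : Type*} [Fintype E] {D : Dimer E} {φ : D.White ≃ D.Black}
  {σ σ' : Equiv.Perm D.White} {p p' : D.White → E} {gw gz q : ℤ × ℤ} {c : E → ℂ} {M : Finset E}

theorem isPerfectMatching_image [DecidableEq E]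
    (hp : ∀ v, D.white (p v) = σ v ∧ D.black (p v) = φ v) :
    D.IsPerfectMatching (Finset.univ.image p) := by
  constructor
  · intro v
    refine ⟨p (σ⁻¹ v), ⟨by simp, by rw [(hp _).1, perm_apply_inv]⟩, ?_⟩
    rintro e ⟨he, rfl⟩
    obtain ⟨u, -, rfl⟩ := Finset.mem_image.1 he
    rw [(hp u).1, perm_inv_apply]
  · intro b
    refine ⟨p (φ.symm b), ⟨by simp, by rw [(hp _).2, Equiv.apply_symm_apply]⟩, ?_⟩
    rintro e ⟨he, rfl⟩
    obtain ⟨u, -, rfl⟩ := Finset.mem_image.1 he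
    rw [(hp u).2, Equiv.symm_apply_apply]

theorem IsPerfectMatching.exists_image_eq [DecidableEq E] (hM : D.IsPerfectMatching M)
    (φ : D.White ≃ D.Black) : ∃ (σ : Equiv.Perm D.White) (p : D.White → E),
      (∀ v, D.white (p v) = σ v ∧ D.black (p v) = φ v) ∧ Finset.univ.image p = M := by
  choose p hp hpu using fun v => hM.2 (φ v)
  have white_injective : Function.Injective fun v => D.white (p v) := fun v v' h => by
    have heq : p v = p v' := (hM.1 _).unique ⟨(hp v).1, rfl⟩ ⟨(hp v').1, h.symm⟩
    exact φ.injective (by rw [← (hp v).2, ← (hp v').2, heq])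
  refine ⟨Equiv.ofBijective _ (Finite.injective_iff_bijective.1 white_injective), p,
    fun v => ⟨rfl, (hp v).2⟩, Finset.Subset.antisymm ?_ fun e he => Finset.mem_image.2 ?_⟩
  · exact Finset.image_subset_iff.2 fun v _ => (hp v).1
  · exact ⟨φ.symm (D.black e), Finset.mem_univ _,
      (hpu _ e ⟨he, (φ.apply_symm_apply _).symm⟩).symm⟩

theorem eq_and_eq_of_image_eq [DecidableEq E]
    (hp : ∀ v, D.white (p v) = σ v ∧ D.black (p v) = φ v)
    (hp' : ∀ v, D.white (p' v) = σ' v ∧ D.black (p' v) = φ v)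
    (h : Finset.univ.image p = Finset.univ.image p') : σ = σ' ∧ p = p' := by
  have hpp : p = p' := funext fun v => ((isPerfectMatching_image hp').2 (φ v)).unique
    ⟨h ▸ Finset.mem_image_of_mem p (Finset.mem_univ v), (hp v).2⟩
    ⟨Finset.mem_image_of_mem p' (Finset.mem_univ v), (hp' v).2⟩
  subst hpp
  exact ⟨Equiv.ext fun v => (hp v).1.symm.trans (hp' v).1, rfl⟩

theorem injective_of_black (hp : ∀ v, D.black (p v) = φ v) : Function.Injective p :=
  fun v v' h => φ.injective (by rw [← hp, ← hp, h])

open Classical in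
theorem kasteleynDet_eq_sum (gw gz : ℤ × ℤ) (c : E → ℂ) (φ : D.White ≃ D.Black) :
    D.kasteleynDet gw gz c φ = ∑ σ : Equiv.Perm D.White,
      ∑ p : D.White → E with ∀ v, D.white (p v) = σ v ∧ D.black (p v) = φ v,
        Equiv.Perm.sign σ •
          AddMonoidAlgebra.single (∑ v, D.exponent gw gz (p v)) (∏ v, c (p v)) := by
  rw [kasteleynDet, Matrix.det_apply]
  refine Finset.sum_congr rfl fun σ _ => ?_
  rw [← Finset.smul_sum]
  simp only [Matrix.submatrix_apply, id, kasteleyn, Finset.prod_univ_sum,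
    AddMonoidAlgebra.prod_single]
  congr 2
  ext p
  simp

open Classical in
/-- The signs are those of the permutations of the white nodes that the matchings induce via `φ`. -/
theorem exists_kasteleynDet_eq_sum (gw gz : ℤ × ℤ) (c : E → ℂ) (φ : D.White ≃ D.Black) :
    ∃ s : {M // D.IsPerfectMatching M} → ℤˣ, D.kasteleynDet gw gz c φ =
      ∑ M, s M • AddMonoidAlgebra.single (D.point gw gz M) (∏ e ∈ M.1, c e) := by
  classical
  choose σ p hp himage using
    fun M : {M // D.IsPerfectMatching M} => M.2.exists_image_eq φ
  refine ⟨fun M => Equiv.Perm.sign (σ M), ?_⟩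
  rw [kasteleynDet_eq_sum, Finset.sum_sigma']
  symm
  refine Finset.sum_bij (fun M _ => ⟨σ M, p M⟩) (fun M _ => by simpa using hp M) ?_ ?_ ?_
  · intro M _ M' _ h
    simp only [Sigma.mk.injEq, heq_eq_eq] at h
    rw [Subtype.ext_iff, ← himage M, ← himage M', h.2]
  · rintro ⟨τ, q⟩ hq
    simp only [Finset.mem_sigma, Finset.mem_univ, true_and, Finset.mem_filter_univ] at hq
    refine ⟨⟨_, isPerfectMatching_image hq⟩, Finset.mem_univ _, ?_⟩
    obtain ⟨hσ, hpq⟩ := eq_and_eq_of_image_eq (hp _) hq (himage ⟨_, isPerfectMatching_image hq⟩)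
    rw [hσ, hpq]
  · intro M _
    have inj : Set.InjOn (p M) (Finset.univ : Finset D.White) :=
      (injective_of_black fun v => (hp M v).2).injOn
    dsimp only
    rw [← Finset.sum_image (g := p M) (f := D.exponent gw gz) inj,
      ← Finset.prod_image (g := p M) (f := c) inj, himage, point]

theorem exists_isPerfectMatching_of_coeff_ne_zero (h : (D.kasteleynDet gw gz c φ).coeff q ≠ 0) :
    ∃ M, D.IsPerfectMatching M ∧ D.point gw gz M = q := by
  obtain ⟨s, hs⟩ := exists_kasteleynDet_eq_sum gw gz c φ
  rw [hs, AddMonoidAlgebra.coeff_sum, Finset.sum_apply'] at h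
  obtain ⟨M, -, hM⟩ := Finset.exists_ne_zero_of_sum_ne_zero h
  refine ⟨M, M.2, by_contra fun hne => hM ?_⟩
  simp [AddMonoidAlgebra.coeff_single, hne]

theorem coeff_kasteleynDet_ne_zero (hc : ∀ e, c e ≠ 0)
    (φ : D.White ≃ D.Black) (hM : D.IsPerfectMatching M)
    (huniq : ∀ M', D.IsPerfectMatching M' → D.point gw gz M' = D.point gw gz M → M' = M) :
    (D.kasteleynDet gw gz c φ).coeff (D.point gw gz M) ≠ 0 := by
  obtain ⟨s, hs⟩ := exists_kasteleynDet_eq_sum gw gz c φ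
  have hprod : ∏ e ∈ M, c e ≠ 0 := Finset.prod_ne_zero_iff.2 fun e _ => hc e
  classical
  rw [hs, AddMonoidAlgebra.coeff_sum, Finset.sum_apply', Finset.sum_eq_single ⟨M, hM⟩]
  · rcases Int.units_eq_one_or (s ⟨M, hM⟩) with h | h <;>
      simpa [AddMonoidAlgebra.coeff_single, h] using hprod
  · intro M' _ hne
    have hpoint : D.point gw gz M' ≠ D.point gw gz M := fun h =>
      hne (Subtype.ext (huniq M' M'.2 h))
    simp [AddMonoidAlgebra.coeff_single, hpoint]
  · exact fun h => absurd (Finset.mem_univ _) h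

end Dimer

/-! ### From displacements to exponents -/

section ExponentMap

variable {R : Type*} [CommRing R]

/-- The linear map that sends the displacement of an edge to the exponent of its weight, for curves
`γ_w`, `γ_z` with windings `g`, `h`. -/
def exponentMap (g h : R × R) : R × R →ₗ[R] R × R where
  toFun x := (wedge x g, wedge x h)
  map_add' x y := by ext <;> simp only [wedge, Prod.fst_add, Prod.snd_add] <;> ring
  map_smul' t x := by
    ext <;> simp only [wedge, Prod.smul_fst, Prod.smul_snd, smul_eq_mul, RingHom.id_apply] <;> ring

/-- The outward normal vector of a boundary segment `v`, read in the basis `g`, `h`. -/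
def normalMap (g h : R × R) : R × R →ₗ[R] R × R where
  toFun v := v.2 • g + (-v.1) • h
  map_add' x y := by simp only [Prod.fst_add, Prod.snd_add]; module
  map_smul' t x := by
    simp only [Prod.smul_fst, Prod.smul_snd, smul_eq_mul, RingHom.id_apply]; module

variable {g h : R × R}

theorem wedge_exponentMap (v x : R × R) :
    wedge v (exponentMap g h x) = wedge (normalMap g h v) x := by
  simp only [exponentMap, normalMap, LinearMap.coe_mk, AddHom.coe_mk, wedge, Prod.fst_add,
    Prod.snd_add, Prod.smul_fst, Prod.smul_snd, smul_eq_mul]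
  ring

theorem exponentMap_normalMap (v : R × R) :
    exponentMap g h (normalMap g h v) = wedge g h • v := by
  ext <;> simp only [exponentMap, normalMap, LinearMap.coe_mk, AddHom.coe_mk, wedge, Prod.fst_add,
    Prod.snd_add, Prod.smul_fst, Prod.smul_snd, smul_eq_mul] <;> ring

theorem normalMap_exponentMap (x : R × R) :
    normalMap g h (exponentMap g h x) = wedge g h • x := by
  ext <;> simp only [exponentMap, normalMap, LinearMap.coe_mk, AddHom.coe_mk, wedge, Prod.fst_add,
    Prod.snd_add, Prod.smul_fst, Prod.smul_snd, smul_eq_mul] <;> ring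

theorem exponentMap_injective [IsDomain R] (hgh : wedge g h ≠ 0) :
    Function.Injective (exponentMap g h) := fun x y hxy => by
  have := congrArg (normalMap g h) hxy
  rwa [normalMap_exponentMap, normalMap_exponentMap, smul_right_inj hgh] at this

theorem normalMap_injective [IsDomain R] (hgh : wedge g h ≠ 0) :
    Function.Injective (normalMap g h) := fun x y hxy => by
  have := congrArg (exponentMap g h) hxy
  rwa [exponentMap_normalMap, exponentMap_normalMap, smul_right_inj hgh] at this

theorem normalMap_surjective (hgh : IsUnit (wedge g h)) :
    Function.Surjective (normalMap g h) := fun x => by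
  obtain ⟨t, ht⟩ := hgh.exists_left_inv
  exact ⟨t • exponentMap g h x, by
    rw [map_smul, normalMap_exponentMap, smul_smul, ht, one_smul]⟩

theorem isCoprime_iff_exists_wedge_eq_one {u : R × R} :
    IsCoprime u.1 u.2 ↔ ∃ x, wedge u x = 1 := by
  constructor
  · rintro ⟨a, b, hab⟩
    exact ⟨(-b, a), by simp only [wedge]; linear_combination hab⟩
  · rintro ⟨x, hx⟩
    exact ⟨x.2, -x.1, by simp only [wedge] at hx; linear_combination hx⟩

theorem isCoprime_of_isCoprime_normalMap {v : R × R}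
    (hv : IsCoprime (normalMap g h v).1 (normalMap g h v).2) : IsCoprime v.1 v.2 := by
  obtain ⟨x, hx⟩ := isCoprime_iff_exists_wedge_eq_one.1 hv
  exact isCoprime_iff_exists_wedge_eq_one.2 ⟨exponentMap g h x, by rw [wedge_exponentMap, hx]⟩

end ExponentMap

theorem toReal_exponentMap (g h u : ℤ × ℤ) :
    toReal (exponentMap g h u) = exponentMap (toReal g) (toReal h) (toReal u) :=
  Prod.ext (wedge_toReal u g).symm (wedge_toReal u h).symm

theorem toReal_normalMap (g h u : ℤ × ℤ) :
    toReal (normalMap g h u) = normalMap (toReal g) (toReal h) (toReal u) := by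
  simp [normalMap, toReal]

theorem minFace_image_exponentMap (g h : ℝ × ℝ) (Δ : Set (ℝ × ℝ)) (v : ℝ × ℝ) :
    minFace (exponentMap g h '' Δ) v = exponentMap g h '' minFace Δ (normalMap g h v) := by
  ext x
  constructor
  · rintro ⟨⟨x, hx, rfl⟩, hmin⟩
    refine ⟨x, ⟨hx, fun y hy => ?_⟩, rfl⟩
    rw [← wedge_exponentMap, ← wedge_exponentMap]
    exact hmin _ ⟨y, hy, rfl⟩
  · rintro ⟨x, ⟨hx, hmin⟩, rfl⟩
    refine ⟨⟨x, hx, rfl⟩, ?_⟩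
    rintro _ ⟨y, hy, rfl⟩
    rw [wedge_exponentMap, wedge_exponentMap]
    exact hmin y hy

theorem exponentMap_image_segment (g h : ℤ × ℤ) (p q : ℤ × ℤ) :
    exponentMap (toReal g) (toReal h) '' segment ℝ (toReal p) (toReal q) =
      segment ℝ (toReal (exponentMap g h p)) (toReal (exponentMap g h q)) := by
  rw [toReal_exponentMap, toReal_exponentMap]
  exact image_segment ℝ (exponentMap (toReal g) (toReal h)).toAffineMap _ _

/-! ### The toric diagram -/

namespace Dimer

variable {E : Type*} [Fintype E] {D : Dimer E} {gw gz w : ℤ × ℤ} {c : E → ℂ}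
  {φ : D.White ≃ D.Black} {r r₁ r₂ : ℝ × ℝ}

theorem point_eq_exponentMap (gw gz : ℤ × ℤ) (M : Finset E) :
    D.point gw gz M = exponentMap gw gz (D.totalDisp M) := by
  rw [totalDisp, map_sum]; rfl

theorem toReal_point (gw gz : ℤ × ℤ) (M : Finset E) : toReal (D.point gw gz M) =
    exponentMap (toReal gw) (toReal gz) (toReal (D.totalDisp M)) := by
  rw [point_eq_exponentMap, toReal_exponentMap]

theorem toricDiagram_subset : D.toricDiagram gw gz c φ ⊆
    exponentMap (toReal gw) (toReal gz) '' D.dispPolygon := by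
  rw [dispPolygon, LinearMap.image_convexHull]
  refine convexHull_mono ?_
  rintro _ ⟨q, hq, rfl⟩
  obtain ⟨M, hM, rfl⟩ := exists_isPerfectMatching_of_coeff_ne_zero (Finsupp.mem_support_iff.1 hq)
  exact ⟨_, ⟨M, hM, rfl⟩, (toReal_point gw gz M).symm⟩

namespace ProperlyOrdered

theorem toReal_point_rayMatching_mem (hD : D.ProperlyOrdered) (hg : wedge gw gz ≠ 0)
    (hc : ∀ e, c e ≠ 0) (hr : D.IsGenericRay r) :
    toReal (D.point gw gz (D.rayMatching r)) ∈ D.toricDiagram gw gz c φ := by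
  refine subset_convexHull ℝ _ ⟨_, Finsupp.mem_support_iff.2 ?_, rfl⟩
  refine coeff_kasteleynDet_ne_zero hc φ (hD.isPerfectMatching_rayMatching hr) fun M hM h => ?_
  rw [point_eq_exponentMap, point_eq_exponentMap] at h
  exact hD.eq_rayMatching_of_totalDisp_eq hr hM (exponentMap_injective hg h)

theorem toricDiagram_eq_image (hD : D.ProperlyOrdered) (hg : wedge gw gz ≠ 0)
    (hc : ∀ e, c e ≠ 0) : D.toricDiagram gw gz c φ =
      exponentMap (toReal gw) (toReal gz) '' D.dispPolygon := by
  refine toricDiagram_subset.antisymm ?_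
  rw [hD.dispPolygon_eq_convexHull, LinearMap.image_convexHull]
  refine convexHull_min ?_ (convex_convexHull ℝ _)
  rintro _ ⟨_, ⟨r, hr, rfl⟩, rfl⟩
  rw [← toReal_point]
  exact hD.toReal_point_rayMatching_mem hg hc hr

theorem extremePoints_toricDiagram (hD : D.ProperlyOrdered) (hg : wedge gw gz ≠ 0)
    (hc : ∀ e, c e ≠ 0) : (D.toricDiagram gw gz c φ).extremePoints ℝ =
      {p | ∃ r, D.IsGenericRay r ∧ p = toReal (D.point gw gz (D.rayMatching r))} := by
  have hgR : wedge (toReal gw) (toReal gz) ≠ 0 := by rw [wedge_toReal]; exact_mod_cast hg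
  have image_eq := image_extremePoints
    (LinearEquiv.ofInjectiveEndo _ (exponentMap_injective hgR)) D.dispPolygon
  rw [LinearEquiv.coe_ofInjectiveEndo] at image_eq
  rw [hD.toricDiagram_eq_image hg hc, ← image_eq, hD.extremePoints_dispPolygon]
  ext p
  constructor
  · rintro ⟨_, ⟨r, hr, rfl⟩, rfl⟩
    exact ⟨r, hr, (toReal_point gw gz _).symm⟩
  · rintro ⟨r, hr, rfl⟩
    exact ⟨_, ⟨r, hr, rfl⟩, (toReal_point gw gz _).symm⟩

theorem minFace_toricDiagram (hD : D.ProperlyOrdered) (hg : wedge gw gz ≠ 0)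
    (hc : ∀ e, c e ≠ 0) (v : ℝ × ℝ) : minFace (D.toricDiagram gw gz c φ) v =
      exponentMap (toReal gw) (toReal gz) ''
        minFace D.dispPolygon (normalMap (toReal gw) (toReal gz) v) := by
  rw [hD.toricDiagram_eq_image hg hc, minFace_image_exponentMap]

theorem minFace_toricDiagram_eq_segment (hD : D.ProperlyOrdered) (hg : wedge gw gz ≠ 0)
    (hc : ∀ e, c e ≠ 0) (h₁ : D.IsGenericRay r₁) (h₂ : D.IsGenericRay r₂)
    (hw : ∃ Z, D.winding Z = w) (h : ∀ Z, Ccw r₁ (D.windingR Z) r₂ ↔ D.winding Z = w)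
    {v : ℝ × ℝ} (hv : normalMap (toReal gw) (toReal gz) v = toReal w) :
    minFace (D.toricDiagram gw gz c φ) v =
      segment ℝ (toReal (D.point gw gz (D.rayMatching r₁)))
        (toReal (D.point gw gz (D.rayMatching r₂))) := by
  rw [hD.minFace_toricDiagram hg hc, hv, hD.minFace_dispPolygon_eq_segment h₁ h₂ hw h,
    exponentMap_image_segment, point_eq_exponentMap, point_eq_exponentMap]

theorem isExtreme_segment (hD : D.ProperlyOrdered) (hg : wedge gw gz ≠ 0)
    (hc : ∀ e, c e ≠ 0) (h₁ : D.IsGenericRay r₁) (h₂ : D.IsGenericRay r₂)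
    (hw : ∃ Z, D.winding Z = w) (h : ∀ Z, Ccw r₁ (D.windingR Z) r₂ ↔ D.winding Z = w) :
    IsExtreme ℝ (D.toricDiagram gw gz c φ)
      (segment ℝ (toReal (D.point gw gz (D.rayMatching r₁)))
        (toReal (D.point gw gz (D.rayMatching r₂)))) := by
  have hgR : wedge (toReal gw) (toReal gz) ≠ 0 := by rw [wedge_toReal]; exact_mod_cast hg
  obtain ⟨v, hv⟩ := normalMap_surjective hgR.isUnit (toReal w)
  rw [← hD.minFace_toricDiagram_eq_segment hg hc h₁ h₂ hw h hv]
  exact isExtreme_minFace _ _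

theorem point_sub_point (hD : D.ProperlyOrdered) (gw gz : ℤ × ℤ) (h₁ : D.IsGenericRay r₁)
    (h₂ : D.IsGenericRay r₂) (hw : ∃ Z, D.winding Z = w)
    (h : ∀ Z, Ccw r₁ (D.windingR Z) r₂ ↔ D.winding Z = w) :
    D.point gw gz (D.rayMatching r₂) - D.point gw gz (D.rayMatching r₁) =
      Nat.card {Z : D.ZigzagPath // D.winding Z = w} • exponentMap gw gz w := by
  rw [point_eq_exponentMap, point_eq_exponentMap, ← map_sub,
    hD.totalDisp_sub_totalDisp_eq_card_smul h₁ h₂ hw h, map_nsmul]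

theorem point_ne_point (hD : D.ProperlyOrdered) (hg : wedge gw gz ≠ 0)
    (h₁ : D.IsGenericRay r₁) (h₂ : D.IsGenericRay r₂) (hw : ∃ Z, D.winding Z = w)
    (h : ∀ Z, Ccw r₁ (D.windingR Z) r₂ ↔ D.winding Z = w) :
    D.point gw gz (D.rayMatching r₁) ≠ D.point gw gz (D.rayMatching r₂) := by
  have : Nonempty {Z : D.ZigzagPath // D.winding Z = w} := hw.elim fun Z hZ => ⟨Z, hZ⟩
  obtain ⟨Z, rfl⟩ := id hw
  rw [← sub_ne_zero.trans ne_comm, hD.point_sub_point gw gz h₁ h₂ hw h]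
  refine smul_ne_zero Nat.card_pos.ne' ?_
  rw [← map_zero (exponentMap gw gz), (exponentMap_injective hg).ne_iff]
  exact hD.winding_ne_zero Z

theorem exists_minFace_toricDiagram_eq_segment (hD : D.ProperlyOrdered)
    (hg : wedge gw gz = 1 ∨ wedge gw gz = -1) (hc : ∀ e, c e ≠ 0) {v : D.ZigzagPath → ℤ × ℤ}
    (hv : ∀ Z, normalMap gw gz (v Z) = D.winding Z) (Z : D.ZigzagPath) :
    ∃ q, minFace (D.toricDiagram gw gz c φ) (toReal (v Z)) =
      segment ℝ (toReal q) (toReal (q + Nat.card {Y // v Y = v Z} • v Z)) := by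
  have hg₀ : wedge gw gz ≠ 0 := by rintro h; simp [h] at hg
  have card_eq : Nat.card {Y // v Y = v Z} =
      Nat.card {Y : D.ZigzagPath // D.winding Y = D.winding Z} := by
    simp only [← hv, (normalMap_injective hg₀).eq_iff]
  obtain ⟨r₁, r₂, h₁, h₂, h⟩ := hD.exists_isGenericRay_adjacent Z
  have face_eq := hD.minFace_toricDiagram_eq_segment (φ := φ) hg₀ hc h₁ h₂ ⟨Z, rfl⟩ h
    (v := toReal (v Z)) (by rw [← toReal_normalMap, hv])
  have hsub := hD.point_sub_point gw gz h₁ h₂ ⟨Z, rfl⟩ h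
  rw [← hv, exponentMap_normalMap, hv, ← card_eq] at hsub
  obtain hg | hg := hg
  · rw [hg, one_smul] at hsub
    exact ⟨D.point gw gz (D.rayMatching r₁), by rw [face_eq, ← hsub, add_sub_cancel]⟩
  · rw [hg, neg_one_smul, smul_neg] at hsub
    exact ⟨D.point gw gz (D.rayMatching r₂), by
      rw [face_eq, segment_symm, ← neg_eq_iff_eq_neg.2 hsub, neg_sub, add_sub_cancel]⟩

theorem subsingleton_minFace_or_exists_eq_nsmul (hD : D.ProperlyOrdered)
    (hg : wedge gw gz ≠ 0) (hc : ∀ e, c e ≠ 0) {v : D.ZigzagPath → ℤ × ℤ}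
    (hv : ∀ Z, normalMap gw gz (v Z) = D.winding Z) {u : ℤ × ℤ} (hu : u ≠ 0) :
    (minFace (D.toricDiagram gw gz c φ) (toReal u)).Subsingleton ∨
      ∃ Z, ∃ n : ℕ, u = n • v Z := by
  by_cases hgen : D.IsGenericRay (toReal (normalMap gw gz u))
  · left
    rw [hD.minFace_toricDiagram hg hc, ← toReal_normalMap,
      hD.minFace_dispPolygon_of_isGenericRay hgen]
    exact Set.subsingleton_singleton.image _
  · right
    have normal_ne : normalMap gw gz u ≠ 0 := by
      rwa [← map_zero (normalMap gw gz), (normalMap_injective hg).ne_iff]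
    obtain ⟨Z, hZ⟩ : ∃ Z, SameDir (toReal (normalMap gw gz u)) (D.windingR Z) := by
      by_contra! h; exact hgen ⟨toReal_ne_zero normal_ne, h⟩
    obtain ⟨n, hn⟩ := exists_nsmul_of_sameDir (hD.isCoprime_winding Z) (sameDir_toReal.1 hZ).symm
    refine ⟨Z, n, normalMap_injective hg ?_⟩
    rw [hn, map_nsmul, hv]

theorem exists_equiv_leg (hD : D.ProperlyOrdered) (hg : wedge gw gz = 1 ∨ wedge gw gz = -1)
    (hc : ∀ e, c e ≠ 0) (φ : D.White ≃ D.Black) :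
    ∃ Φ : D.ZigzagPath ≃ Leg (D.toricDiagram gw gz c φ),
      ∀ Z, D.winding Z = (Φ Z).vec.1 • gw + (Φ Z).vec.2 • gz := by
  have hg_unit : IsUnit (wedge gw gz) := Int.isUnit_iff.2 hg
  choose v hv using fun Z => normalMap_surjective hg_unit (D.winding Z)
  obtain ⟨Φ, hΦ⟩ := Leg.exists_equiv (Δ := D.toricDiagram gw gz c φ) (w := v)
    (fun Z => isCoprime_of_isCoprime_normalMap (by rw [hv]; exact hD.isCoprime_winding Z))
    (hD.exists_minFace_toricDiagram_eq_segment hg hc hv)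
    fun u hu => hD.subsingleton_minFace_or_exists_eq_nsmul hg_unit.ne_zero hc hv hu
  refine ⟨Φ, fun Z => ?_⟩
  rw [← hv, ← hΦ]
  rfl

theorem card_white_eq_card_black (hD : D.ProperlyOrdered) :
    Nat.card D.White = Nat.card D.Black := by
  obtain ⟨e⟩ := D.nonempty_edge
  obtain ⟨r, -, hr, -⟩ := hD.exists_isGenericRay_adjacent (D.zigOut e)
  exact (hD.isPerfectMatching_rayMatching hr).card_white_eq_card_black

end ProperlyOrdered

end Dimer

theorem mainTheorem2 {E : Type*} [Fintype E] (D : Dimer E) (hD : D.ProperlyOrdered)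
    (gw gz : ℤ × ℤ) (hg : wedge gw gz = 1 ∨ wedge gw gz = -1)
    (c : E → ℂ) (hc : ∀ e, c e ≠ 0) :
    -- the Kasteleyn matrix is square
    Nat.card D.White = Nat.card D.Black ∧
    ∀ φ : D.White ≃ D.Black,
      -- zigzag paths correspond to legs, and windings (in the basis `gw`, `gz`) to leg vectors
      (∃ Φ : D.ZigzagPath ≃ Leg (D.toricDiagram gw gz c φ),
        ∀ Z, D.winding Z = (Φ Z).vec.1 • gw + (Φ Z).vec.2 • gz) ∧
      -- the sets of edges attached to rays are perfect matchings
      (∀ r, D.IsGenericRay r → D.IsPerfectMatching (D.rayMatching r)) ∧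
      -- they lie at the corners of the toric diagram, and every corner arises in this way
      (D.toricDiagram gw gz c φ).extremePoints ℝ =
        {p | ∃ r, D.IsGenericRay r ∧ p = toReal (D.point gw gz (D.rayMatching r))} ∧
      -- rays with just one winding direction between them yield consecutive corners, which differ
      -- by the rotated sum of the windings of the zigzag paths of that direction
      (∀ r₁ r₂ w, D.IsGenericRay r₁ → D.IsGenericRay r₂ → (∃ Z, D.winding Z = w) →
        (∀ Z, Ccw r₁ (D.windingR Z) r₂ ↔ D.winding Z = w) →
        D.point gw gz (D.rayMatching r₁) ≠ D.point gw gz (D.rayMatching r₂) ∧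
        IsExtreme ℝ (D.toricDiagram gw gz c φ)
          (segment ℝ (toReal (D.point gw gz (D.rayMatching r₁)))
            (toReal (D.point gw gz (D.rayMatching r₂)))) ∧
        D.point gw gz (D.rayMatching r₂) - D.point gw gz (D.rayMatching r₁) =
          Nat.card {Z : D.ZigzagPath // D.winding Z = w} • (wedge w gw, wedge w gz)) := by
  have hg₀ : wedge gw gz ≠ 0 := (Int.isUnit_iff.2 hg).ne_zero
  exact ⟨hD.card_white_eq_card_black, fun φ =>
    ⟨hD.exists_equiv_leg hg hc φ,
      fun _ hr => hD.isPerfectMatching_rayMatching hr,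
      hD.extremePoints_toricDiagram hg₀ hc,
      fun _ _ _ h₁ h₂ hw h => ⟨hD.point_ne_point hg₀ h₁ h₂ hw h,
        hD.isExtreme_segment hg₀ hc h₁ h₂ hw h, hD.point_sub_point gw gz h₁ h₂ hw h⟩⟩⟩
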